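/- Work over $\mathbb C$. Let $X$ be an $n$-dimensional projective manifold (a smooth integral projective scheme over $\mathbb C$ of dimension $n$), and let $f\colon X\to C$ be a fibration onto a curve: $C$ is an integral projective scheme over $\mathbb C$ of dimension $1$, and $f$ is a surjective proper morphism over $\mathbb C$ such that $\mathcal O_C\to f_*\mathcal O_X$ is an isomorphism. Let $H$ be an ample divisor on $X$, let $p\in C$ be a closed point, and let $F=f^{-1}(p)$ be the scheme-theoretic fiber, regarded also as an effective Cartier divisor on $X$, so that $\mathcal O_X(-F)$ is the ideal sheaf of $F$. (In particular $F$ may be a general fiber.) Let $m_0\in\mathbb N$ be such that, for all $m\ge m_0$ and all $i>0$, $$h^i(X,\mathcal O_X(mH))=0\qquad\text{and}\qquad h^i(F,\mathcal O_X(mH)|_F)=0 .$$ Then $$h^i(X,\mathcal O_X(mH-kF))=0\qquad\text{for all } i>1,\ \text{all } m\ge m_0\ \text{and all } k\in\mathbb N .$$ In particular, for all positive integers $a,b$, the divisor $D_{a,b}=aH-bF$ satisfies the following: there is $m_1$ such that $h^i(X,\mathcal O_X(mD_{a,b}))=0$ for all $m\ge m_1$ and all $i>1$. -/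

import Mathlib

open CategoryTheory AlgebraicGeometry TopologicalSpace Opposite

noncomputable section

/-! ### Projective complex varieties -/

attribute [local instance] MvPolynomial.gradedAlgebra

/-- Projective `n`-space over `ℂ`, as `Proj` of the standard graded polynomial ring. -/
def complexProjectiveSpace (n : ℕ) : Scheme.{0} :=
  Proj (MvPolynomial.homogeneousSubmodule (Fin (n + 1)) ℂ)

/-- The structure morphism of projective `n`-space over `ℂ`. -/
def complexProjectiveSpaceToSpec (n : ℕ) :
    complexProjectiveSpace n ⟶ Spec (CommRingCat.of ℂ) :=
  Proj.toSpecZero (MvPolynomial.homogeneousSubmodule (Fin (n + 1)) ℂ) ≫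
    Spec.map (CommRingCat.ofHom
      (algebraMap ℂ (MvPolynomial.homogeneousSubmodule (Fin (n + 1)) ℂ 0)))

/-- A `ℂ`-scheme is projective if it is a closed subscheme of some projective space over `ℂ`. -/
def IsProjectiveOverComplex {X : Scheme.{0}} (π : X ⟶ Spec (CommRingCat.of ℂ)) : Prop :=
  ∃ (n : ℕ) (j : X ⟶ complexProjectiveSpace n),
    IsClosedImmersion j ∧ j ≫ complexProjectiveSpaceToSpec n = π

/-- An integral `ℂ`-scheme is a projective manifold of dimension `n` if it is projective and smooth
over `ℂ` and has dimension `n`. -/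
structure IsProjectiveManifold {X : Scheme.{0}} [IsIntegral X]
    (π : X ⟶ Spec (CommRingCat.of ℂ)) (n : ℕ) : Prop where
  projective : IsProjectiveOverComplex π
  smooth : Smooth π
  dim_eq : topologicalKrullDim X = n

/-- A projective curve: an integral projective `ℂ`-scheme of dimension one. -/
structure IsProjectiveCurve {C : Scheme.{0}} (π : C ⟶ Spec (CommRingCat.of ℂ)) : Prop where
  integral : IsIntegral C
  projective : IsProjectiveOverComplex π
  dim_eq : topologicalKrullDim C = 1

/-- An algebraic fiber space (fibration): a surjective proper morphism `f : X ⟶ Y` such that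
`𝒪_Y ⟶ f_* 𝒪_X` is an isomorphism. -/
structure IsAlgebraicFiberSpace {X Y : Scheme.{0}} (f : X ⟶ Y) : Prop where
  surjective : Function.Surjective f
  proper : IsProper f
  isIso_app : ∀ U : Y.Opens, IsIso (f.app U)

/-! ### Cartier divisors on integral schemes -/

namespace AlgebraicGeometry.Scheme

variable (X : Scheme.{0}) [IsIntegral X]

/-- The image of `𝒪_{X,x}ˣ` in `K(X)ˣ`. -/
def stalkUnits (x : X) : Subgroup (X.functionField)ˣ :=
  (Units.map (algebraMap (X.presheaf.stalk x) X.functionField).toMonoidHom).range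

/-- The group of global sections of `K(X)ˣ / 𝒪_Xˣ`, written multiplicatively: families of classes
`D x ∈ K(X)ˣ / 𝒪_{X,x}ˣ` which locally on `X` are given by one rational function. -/
def cartierSubgroup : Subgroup (∀ x : X, (X.functionField)ˣ ⧸ X.stalkUnits x) where
  carrier := {D | ∀ x : X, ∃ U : X.Opens, x ∈ U ∧ ∃ φ : (X.functionField)ˣ,
    ∀ y ∈ U, D y = QuotientGroup.mk φ}
  one_mem' := fun _ => ⟨⊤, trivial, 1, fun _ _ => rfl⟩
  mul_mem' := by
    intro D E hD hE x
    obtain ⟨U, hxU, φ, hφ⟩ := hD x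
    obtain ⟨V, hxV, ψ, hψ⟩ := hE x
    exact ⟨U ⊓ V, ⟨hxU, hxV⟩, φ * ψ, fun y hy => by
      rw [Pi.mul_apply, hφ y hy.1, hψ y hy.2]; rfl⟩
  inv_mem' := by
    intro D hD x
    obtain ⟨U, hxU, φ, hφ⟩ := hD x
    exact ⟨U, hxU, φ⁻¹, fun y hy => by rw [Pi.inv_apply, hφ y hy]; rfl⟩

/-- The additive group of Cartier divisors on an integral scheme. -/
abbrev CartierDivisor : Type := Additive X.cartierSubgroup

variable {X}

namespace CartierDivisor

/-- The class in `K(X)ˣ / 𝒪_{X,x}ˣ` of the local equations of `D` at `x`. -/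
def germ (D : X.CartierDivisor) (x : X) : (X.functionField)ˣ ⧸ X.stalkUnits x :=
  (Additive.toMul D).1 x

/-- The rational function `g` lies in `𝒪_X(D)_x = φ⁻¹ 𝒪_{X,x} ⊆ K(X)`, where `φ` is a local
equation of `D` at `x`; that is, `div g + D` is effective at `x`. -/
def MemStalk (D : X.CartierDivisor) (x : X) (g : X.functionField) : Prop :=
  ∀ φ : (X.functionField)ˣ, QuotientGroup.mk φ = D.germ x →
    g * φ ∈ (algebraMap (X.presheaf.stalk x) X.functionField).range

/-- The rational function `g ≠ 0` generates `𝒪_X(D)_x`; that is, `div g + D` is zero at `x`. -/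
def IsGenerator (D : X.CartierDivisor) (x : X) (g : (X.functionField)ˣ) : Prop :=
  (QuotientGroup.mk g : (X.functionField)ˣ ⧸ X.stalkUnits x) * D.germ x = 1

/-- `D` is ample: the open sets `X_s` with `s ∈ H⁰(X, 𝒪_X(nD))`, `n ≥ 1`, which are affine
cover `X`. Here `X_s` is the set of points at which `s` generates `𝒪_X(nD)`. -/
def IsAmple (D : X.CartierDivisor) : Prop :=
  ∀ x : X, ∃ n : ℕ, 1 ≤ n ∧ ∃ s : (X.functionField)ˣ, (∀ y : X, (n • D).MemStalk y s) ∧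
    ∃ U : X.Opens, IsAffineOpen U ∧ x ∈ U ∧ ∀ y : X, y ∈ U ↔ (n • D).IsGenerator y s

/-- The closed subscheme `i : Z ⟶ X` is the effective Cartier divisor `D`:
the ideal sheaf of `Z` is `𝒪_X(-D)`, as subsheaves of `K(X)`. -/
def IsDivisorOf {Z : Scheme.{0}} (D : X.CartierDivisor) (i : Z ⟶ X) : Prop :=
  ∀ (U : X.Opens) [Nonempty U] (g : X.functionField),
    (∀ x ∈ U, (-D).MemStalk x g) ↔ ∃ s : Γ(X, U), i.app U s = 0 ∧ X.germToFunctionField U s = g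

/-! ### The sheaf `𝒪_X(D)` -/

lemma MemStalk.add {D : X.CartierDivisor} {x : X} {g h : X.functionField}
    (hg : D.MemStalk x g) (hh : D.MemStalk x h) : D.MemStalk x (g + h) := fun φ hφ => by
  rw [add_mul]; exact add_mem (hg φ hφ) (hh φ hφ)

lemma memStalk_zero (D : X.CartierDivisor) (x : X) : D.MemStalk x 0 := fun φ _ => by
  rw [zero_mul]; exact zero_mem _

lemma MemStalk.neg {D : X.CartierDivisor} {x : X} {g : X.functionField}
    (hg : D.MemStalk x g) : D.MemStalk x (-g) := fun φ hφ => by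
  rw [neg_mul]; exact neg_mem (hg φ hφ)

lemma MemStalk.smul {D : X.CartierDivisor} {x : X} {g : X.functionField}
    (hg : D.MemStalk x g) (r : X.presheaf.stalk x) :
    D.MemStalk x (algebraMap (X.presheaf.stalk x) X.functionField r * g) := fun φ hφ => by
  rw [mul_assoc]; exact mul_mem ⟨r, rfl⟩ (hg φ hφ)

/-- A section of `𝒪_X` as a function with values in `K(X)` (it is constant). -/
def ratFun (U : X.Opens) : Γ(X, U) →+* (U → X.functionField) :=
  RingHom.pi fun x => (algebraMap (X.presheaf.stalk x.1) X.functionField).comp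
    (X.presheaf.germ U x.1 x.2).hom

lemma ratFun_const (U : X.Opens) (r : Γ(X, U)) (x y : U) : ratFun U r x = ratFun U r y := by
  have : Nonempty U := ⟨x⟩
  exact (X.algebraMap_germ_eq_germToFunctionField x.2 r).trans
    (X.algebraMap_germ_eq_germToFunctionField y.2 r).symm

/-- `Γ(X, U)` acts on functions with values in `K(X)`. -/
instance funModule (U : X.Opens) : Module Γ(X, U) (U → X.functionField) :=
  Module.compHom _ (ratFun U)

lemma funModule_smul_apply (U : X.Opens) (r : Γ(X, U)) (s : U → X.functionField) (x : U) :
    (r • s) x = ratFun U r x * s x := rfl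

/-- `Γ(U, 𝒪_X(D))`: the rational functions `g` with `g ∈ 𝒪_X(D)_x` for all `x ∈ U`. They are
written as constant functions on `U`, so that the sections over `∅` are `0`. -/
def sections (D : X.CartierDivisor) (U : X.Opens) : Submodule Γ(X, U) (U → X.functionField) where
  carrier := {s | (∀ x y, s x = s y) ∧ ∀ x : U, D.MemStalk x.1 (s x)}
  zero_mem' := ⟨fun _ _ => rfl, fun x => D.memStalk_zero x⟩
  add_mem' := fun hs ht =>
    ⟨fun x y => congrArg₂ (· + ·) (hs.1 x y) (ht.1 x y), fun x => (hs.2 x).add (ht.2 x)⟩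
  smul_mem' := fun r _ hs =>
    ⟨fun x y => congrArg₂ (· * ·) (ratFun_const U r x y) (hs.1 x y), fun x => (hs.2 x).smul _⟩

lemma ratFun_res {U V : X.Opens} (i : V ⟶ U) (r : Γ(X, U)) (x : V) :
    ratFun V (X.presheaf.map i.op r) x = ratFun U r ⟨x.1, i.le x.2⟩ := by
  exact congrArg (algebraMap (X.presheaf.stalk x.1) X.functionField)
    (TopCat.Presheaf.germ_res_apply X.presheaf i x.1 x.2 r)

/-- Restriction of functions with values in `K(X)`. -/
def funRes {U V : X.Opens} (i : V ⟶ U) (s : U → X.functionField) : V → X.functionField :=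
  fun x => s ⟨x.1, i.le x.2⟩

lemma funRes_mem (D : X.CartierDivisor) {U V : X.Opens} (i : V ⟶ U) {s : U → X.functionField}
    (hs : s ∈ D.sections U) : funRes i s ∈ D.sections V :=
  ⟨fun x y => hs.1 ⟨x.1, i.le x.2⟩ ⟨y.1, i.le y.2⟩, fun x => hs.2 ⟨x.1, i.le x.2⟩⟩

/-- Restriction of sections of `𝒪_X(D)`. -/
def res (D : X.CartierDivisor) {U V : X.Opens} (i : V ⟶ U) : D.sections U →+ D.sections V where
  toFun s := ⟨funRes i s.1, D.funRes_mem i s.2⟩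
  map_zero' := rfl
  map_add' _ _ := rfl

lemma res_smul (D : X.CartierDivisor) {U V : X.Opens} (i : V ⟶ U) (r : Γ(X, U))
    (s : D.sections U) : D.res i (r • s) = X.presheaf.map i.op r • D.res i s :=
  Subtype.ext <| funext fun x =>
    congrArg (· * s.1 ⟨x.1, i.le x.2⟩) (ratFun_res i r x).symm

/-- `𝒪_X(D)` as a presheaf of modules. -/
def presheafOfModules (D : X.CartierDivisor) : X.PresheafOfModules where
  obj U := ModuleCat.of Γ(X, U.unop) (D.sections U.unop)
  map {_ V} i := ModuleCat.ofHom
    (Y := (ModuleCat.restrictScalars (X.presheaf.map i).hom).obj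
      (ModuleCat.of Γ(X, V.unop) (D.sections V.unop)))
    { toFun := D.res i.unop
      map_add' := (D.res i.unop).map_add
      map_smul' := D.res_smul i.unop }
  map_id _ := rfl
  map_comp _ _ := rfl

/-- The presheaf of abelian groups underlying `𝒪_X(D)` is a sheaf. -/
lemma isSheaf (D : X.CartierDivisor) :
    Presheaf.IsSheaf (Opens.grothendieckTopology X) D.presheafOfModules.presheaf := by
  refine (TopCat.Presheaf.isSheaf_iff_isSheaf_comp (CategoryTheory.forget AddCommGrpCat) _).2 ?_
  refine TopCat.Presheaf.isSheaf_of_isSheafUniqueGluing_types _ ?_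
  intro ι U sf hsf
  let t : ∀ i, D.sections (U i) := sf
  have key : ∀ (i j : ι) (x : U i) (y : U j), (t i).1 x = (t j).1 y := by
    intro i j x y
    have hi : genericPoint X ∈ U i :=
      ((genericPoint_spec X).mem_open_set_iff (U i).isOpen).2 (by simpa using ⟨x.1, x.2⟩)
    have hj : genericPoint X ∈ U j :=
      ((genericPoint_spec X).mem_open_set_iff (U j).isOpen).2 (by simpa using ⟨y.1, y.2⟩)
    have h : D.res (Opens.infLELeft (U i) (U j)) (t i) =
        D.res (Opens.infLERight (U i) (U j)) (t j) := hsf i j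
    have h' : (t i).1 ⟨genericPoint X, hi⟩ = (t j).1 ⟨genericPoint X, hj⟩ :=
      congrFun (congrArg Subtype.val h)
        (⟨genericPoint X, hi, hj⟩ : (U i ⊓ U j : X.Opens))
    exact ((t i).2.1 _ _).trans (h'.trans ((t j).2.1 _ _))
  have hx : ∀ x : (iSup U : X.Opens), ∃ i, x.1 ∈ U i := fun x => Opens.mem_iSup.1 x.2
  choose c hc using hx
  let s : D.sections (iSup U) := ⟨fun x => (t (c x)).1 ⟨x.1, hc x⟩,
    fun x y => key _ _ _ _, fun x => (t (c x)).2.2 ⟨x.1, hc x⟩⟩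
  refine ⟨s, fun i => ?_, fun s' hs' => ?_⟩
  · exact Subtype.ext (a1 := D.res (Opens.leSupr U i) s) (a2 := t i) <| funext fun x => key _ _ _ _
  · refine Subtype.ext (a1 := (s' : D.sections (iSup U))) (a2 := s) <| funext fun x => ?_
    have h : D.res (Opens.leSupr U (c x)) s' = t (c x) := hs' (c x)
    exact congrFun (congrArg Subtype.val h) (⟨x.1, hc x⟩ : U (c x))

/-- The sheaf of `𝒪_X`-modules `𝒪_X(D)` associated with a Cartier divisor `D`. -/
def sheaf (D : X.CartierDivisor) : X.Modules where
  val := D.presheafOfModules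
  isSheaf := D.isSheaf

end CartierDivisor

/-- The sheaf cohomology group `Hⁱ(Y, M)` of a sheaf of modules `M` on a scheme `Y`. -/
abbrev Modules.cohomology {Y : Scheme.{0}} (M : Y.Modules) (i : ℕ) : Type :=
  CategoryTheory.Sheaf.H ((SheafOfModules.toSheaf Y.ringCatSheaf).obj M) i

/-- `hⁱ(Y, M) = 0`, that is, `Hⁱ(Y, M)` is the zero group. -/
def Modules.CohomologyVanishes {Y : Scheme.{0}} (M : Y.Modules) (i : ℕ) : Prop :=
  Subsingleton (M.cohomology i)

end AlgebraicGeometry.Scheme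

end

/-! The engine is the exact sequence `0 ⟶ 𝒪(mH - (k+1)F) ⟶ 𝒪(mH - kF) ⟶ 𝒪(mH)|_F ⟶ 0` together with
induction on `k`. In degree `i > 1` the cohomology of the left term lies between `Hⁱ⁻¹` of the right
term, which vanishes because `i - 1 > 0`, and `Hⁱ` of the middle term, which vanishes by induction.
In degree one the argument stops, since `H⁰` of the fiber need not vanish.

The natural right term is `𝒪(mH - kF)|_F`, so `𝒪(F)` has to be trivial near `F`. As `C` may be
singular at `p`, the maximal ideal `𝔪` of `p` is not known in advance to be principal near `p`. In
`exists_equation_near_fiber` the classical criterion for discrete valuation rings is run with `f_*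
𝒪_X = 𝒪_C` in place of normality. Take `a ≠ 0` in `𝔪` and `y ∉ (a)` with `y𝔪 ⊆ (a)`. If `y/a` maps
`𝔪` into itself, it preserves the invertible ideal sheaf of `F`, hence is regular on `X`, hence on
`C`, a contradiction. Otherwise some `c ∈ 𝔪` is sent to a unit at `p`, and `c` generates `𝔪` near
`p`.

The pullback `i^*` is known only through its adjunction, so exactness rests on two facts about the
unit `𝒪(D) ⟶ i_* i^* 𝒪(D)`: it is locally surjective (`isLocallyPulledBack`), and its kernel is `𝒪(D
- F)` (`unit_app_eq_zero_iff`). Finally, `subsingleton_H_directImage` carries the vanishing on `F`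
over to the direct image on `X`. -/

noncomputable section

/-! ### Cohomology of direct images along closed embeddings. -/

namespace TopCat

universe u

variable {X Y : TopCat.{u}} (f : X ⟶ Y)

/-- Abelian sheaves on a topological space. -/
abbrev AbSheaf (X : TopCat.{u}) := CategoryTheory.Sheaf (Opens.grothendieckTopology X) AddCommGrpCat.{u}

/-- The direct image of abelian sheaves. -/
abbrev directImage : AbSheaf X ⥤ AbSheaf Y :=
  (Opens.map f).sheafPushforwardContinuous AddCommGrpCat.{u} (Opens.grothendieckTopology Y)
    (Opens.grothendieckTopology X)

/-- A morphism of abelian sheaves is an epimorphism iff it is surjective on sections, locally. -/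
lemma AbSheaf.epi_iff {F G : AbSheaf X} (φ : F ⟶ G) :
    Epi φ ↔ ∀ (U : Opens X) (s : G.obj.obj (op U)), ∀ x ∈ U, ∃ (V : Opens X) (i : V ⟶ U),
      x ∈ V ∧ ∃ t : F.obj.obj (op V), φ.hom.app (op V) t = G.obj.map i.op s := by
  rw [← CategoryTheory.Sheaf.isLocallySurjective_iff_epi' (A := AddCommGrpCat.{u})]
  constructor
  · intro h U s x hx
    obtain ⟨V, i, ⟨t, ht⟩, hxV⟩ := Presheaf.imageSieve_mem (Opens.grothendieckTopology X) φ.hom s x hx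
    exact ⟨V, i, hxV, t, ht⟩
  · intro h
    refine ⟨fun {U} s x hx => ?_⟩
    obtain ⟨V, i, hxV, t, ht⟩ := h U s x hx
    exact ⟨V, i, ⟨t, ht⟩, hxV⟩

lemma AbSheaf.mono_iff {F G : AbSheaf X} (φ : F ⟶ G) :
    Mono φ ↔ ∀ U : Opens X, Function.Injective (φ.hom.app (op U)) := by
  rw [CategoryTheory.Sheaf.Hom.mono_iff_presheaf_mono, NatTrans.mono_iff_mono_app]
  simp only [AddCommGrpCat.mono_iff_injective]
  exact ⟨fun h U => h (op U), fun h U => h U.unop⟩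

lemma AbSheaf.subsingleton_of_eq_bot (F : AbSheaf X) {U : Opens X} (hU : U = ⊥) :
    Subsingleton (F.obj.obj (op U)) := by
  have := AddCommGrpCat.subsingleton_of_isZero
    ((Limits.isZero_zero AddCommGrpCat).of_iso
      ((TopCat.Sheaf.isTerminalOfEqEmpty (F : TopCat.Sheaf AddCommGrpCat X) hU).uniqueUpToIso
        (Limits.isZero_zero AddCommGrpCat).isTerminal))
  exact this

variable {f}

/-- At a point of the image, a local lift over an open subset of `X` becomes a lift over an open
subset of `Y`, because the topology of `X` is induced. Off the image, which is closed, there is a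
neighborhood with empty preimage, over which all sections are zero. -/
lemma directImage_map_epi (hf : Topology.IsClosedEmbedding f) {F G : AbSheaf X} (φ : F ⟶ G)
    [h : Epi φ] : Epi ((directImage f).map φ) := by
  rw [AbSheaf.epi_iff] at h ⊢
  intro U s y hy
  by_cases hyr : y ∈ Set.range f
  · obtain ⟨x, rfl⟩ := hyr
    obtain ⟨V, i, hxV, t, ht⟩ := h ((Opens.map f).obj U) s x hy
    obtain ⟨W, hW, hWV⟩ := hf.isInducing.isOpen_iff.1 V.isOpen
    have hx : f x ∈ W := by rw [← Set.mem_preimage, hWV]; exact hxV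
    have hle : (Opens.map f).obj (⟨W, hW⟩ ⊓ U) ≤ V := fun z hz => by
      have : z ∈ f ⁻¹' W := hz.1
      rw [hWV] at this; exact this
    refine ⟨⟨W, hW⟩ ⊓ U, homOfLE inf_le_right, ⟨hx, hy⟩, F.obj.map (homOfLE hle).op t, ?_⟩
    change φ.hom.app _ (F.obj.map (homOfLE hle).op t) = G.obj.map _ s
    rw [NatTrans.naturality_apply, ht]
    exact (ConcreteCategory.congr_hom (G.obj.map_comp i.op (homOfLE hle).op) s).symm
  · refine ⟨U ⊓ ⟨(Set.range f)ᶜ, hf.isClosed_range.isOpen_compl⟩, homOfLE inf_le_left, ⟨hy, hyr⟩, 0, ?_⟩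
    have := G.subsingleton_of_eq_bot (U := (Opens.map f).obj
      (U ⊓ ⟨(Set.range f)ᶜ, hf.isClosed_range.isOpen_compl⟩)) (by
        ext z; simp)
    exact Subsingleton.elim (α := G.obj.obj (op ((Opens.map f).obj
      (U ⊓ ⟨(Set.range f)ᶜ, hf.isClosed_range.isOpen_compl⟩)))) _ _

variable (f) in
instance : (directImage f).IsRightAdjoint :=
  ((Opens.map f).sheafAdjunctionContinuous AddCommGrpCat.{u} _ _).isRightAdjoint

-- The left adjoint, inverse image, is exact and so preserves monomorphisms.
variable (f) in
instance : (directImage f).PreservesInjectiveObjects := by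
  have : Limits.PreservesFiniteLimits ((Opens.map f).sheafPullback AddCommGrpCat.{u}
      (Opens.grothendieckTopology Y) (Opens.grothendieckTopology X)) :=
    Functor.SmallCategories.instPreservesFiniteLimitsSheafSheafPullbackOfRepresentablyFlat _ _ _ _
  have : ((Opens.map f).sheafPullback AddCommGrpCat.{u} (Opens.grothendieckTopology Y)
      (Opens.grothendieckTopology X)).PreservesMonomorphisms :=
    CategoryTheory.preservesMonomorphisms_of_preservesLimitsOfShape _
  exact Functor.preservesInjectiveObjects_of_adjunction_of_preservesMonomorphisms
    ((Opens.map f).sheafAdjunctionContinuous AddCommGrpCat.{u} (Opens.grothendieckTopology Y)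
      (Opens.grothendieckTopology X))

variable (f) in
instance : (directImage f).Additive where

lemma directImage_shortExact (hf : Topology.IsClosedEmbedding f) {S : ShortComplex (AbSheaf X)}
    (hS : S.ShortExact) : (S.map (directImage f)).ShortExact := by
  have : Limits.PreservesLimits (directImage f) :=
    ((Opens.map f).sheafAdjunctionContinuous AddCommGrpCat.{u} (Opens.grothendieckTopology Y)
      (Opens.grothendieckTopology X)).rightAdjoint_preservesLimits
  have hfl : Limits.PreservesFiniteLimits (directImage f) := inferInstance
  have h := ((directImage f).preservesFiniteLimits_tfae.out 3 0 rfl rfl).1 hfl S hS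
  have := hS.epi_g
  exact { exact := h.1, mono_f := h.2, epi_g := directImage_map_epi hf S.g }

/-- The higher cohomology of the direct image of an abelian sheaf along a closed embedding vanishes
if the higher cohomology of the sheaf does. -/
theorem subsingleton_H_directImage (hf : Topology.IsClosedEmbedding f) (j : ℕ) (N : AbSheaf X)
    (hN : ∀ i, 0 < i → Subsingleton (Sheaf.H N i)) (hj : 0 < j) :
    Subsingleton (Sheaf.H ((directImage f).obj N) j) := by
  induction j generalizing N with
  | zero => exact absurd hj (lt_irrefl 0)
  | succ j ih =>
    -- Dimension shifting: the direct image of an injective sheaf is injective, so every class in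
    -- degree `j + 1` is the boundary of a class `y` on the direct image of the cokernel. It
    -- vanishes once `y` lifts to the direct image of the injective sheaf.
    let I : InjectivePresentation N := Classical.arbitrary _
    let S := ShortComplex.mk _ _ (Limits.cokernel.condition I.f)
    have hS : S.ShortExact := { exact := ShortComplex.exact_cokernel I.f }
    have hS' := directImage_shortExact hf hS
    have hI : Injective (S.map (directImage f)).X₂ :=
      (directImage f).injective_obj_of_injective I.injective
    have hI' : Injective S.X₂ := I.injective
    refine subsingleton_of_forall_eq 0 fun x => ?_
    obtain ⟨y, rfl⟩ := Abelian.Ext.covariant_sequence_exact₁ _ hS' x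
      (Abelian.Ext.eq_zero_of_injective _) rfl
    suffices h : ∃ z : Sheaf.H (S.map (directImage f)).X₂ j, Sheaf.H.map (S.map (directImage f)).g j z = y by
      obtain ⟨z, rfl⟩ := h
      rw [Sheaf.H.map_apply, Abelian.Ext.comp_assoc (h₁₂ := add_zero j) (h₂₃ := zero_add 1) (h := rfl),
        hS'.comp_extClass, Abelian.Ext.comp_zero]
      rfl
    -- In degree zero, global sections of a direct image are global sections on `X`, where lifting
    -- is granted by `H¹(N) = 0`. In positive degree the cokernel again has no higher cohomology, so
    -- `y = 0` by induction.
    rcases Nat.eq_zero_or_pos j with rfl | hj'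
    · have hT : Limits.IsTerminal (⊤ : Opens X) := Limits.isTerminalTop
      have hT' : Limits.IsTerminal (⊤ : Opens Y) := Limits.isTerminalTop
      let s : S.X₃.obj.obj (op ⊤) := Sheaf.H.equiv₀ (S.map (directImage f)).X₃ hT' y
      have := hN 1 one_pos
      obtain ⟨z, hz⟩ := Abelian.Ext.covariant_sequence_exact₃ _ hS ((Sheaf.H.equiv₀ S.X₃ hT).symm s)
        (n₁ := 1) rfl (Subsingleton.elim (α := Sheaf.H N 1) _ _)
      let z' : (S.map (directImage f)).X₂.obj.obj (op ⊤) := Sheaf.H.equiv₀ S.X₂ hT z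
      refine ⟨(Sheaf.H.equiv₀ (S.map (directImage f)).X₂ hT').symm z',
        (Sheaf.H.equiv₀_symm_naturality hT' (S.map (directImage f)).g z').trans ?_⟩
      rw [AddEquiv.symm_apply_eq]
      have h2 := Sheaf.H.equiv₀_naturality hT S.g z
      rw [Sheaf.H.map_apply, hz, AddEquiv.apply_symm_apply] at h2
      exact h2
    · have : Subsingleton (Sheaf.H (S.map (directImage f)).X₃ j) := by
        refine ih S.X₃ (fun i hi => subsingleton_of_forall_eq 0 fun x => ?_) hj'
        obtain ⟨y, rfl⟩ := Abelian.Ext.covariant_sequence_exact₃ _ hS x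
          (n₁ := i + 1) rfl (have := hN (i + 1) i.succ_pos; Subsingleton.elim (α := Sheaf.H N (i + 1)) _ _)
        obtain ⟨i, rfl⟩ := Nat.exists_eq_succ_of_ne_zero hi.ne'
        rw [Abelian.Ext.eq_zero_of_injective y, Abelian.Ext.zero_comp]
      exact ⟨0, Subsingleton.elim _ _⟩

end TopCat

-- Noetherian and one-dimensional properties of the curve.

attribute [local instance] MvPolynomial.gradedAlgebra

lemma IsProjectiveOverComplex.isLocallyNoetherian {X : Scheme.{0}}
    {π : X ⟶ Spec (CommRingCat.of ℂ)} (hπ : IsProjectiveOverComplex π) : IsLocallyNoetherian X := by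
  obtain ⟨n, j, hj, -⟩ := hπ
  let 𝒜 := MvPolynomial.homogeneousSubmodule (Fin (n + 1)) ℂ
  have : IsScalarTower ℂ (𝒜 0) (MvPolynomial (Fin (n + 1)) ℂ) :=
    ⟨fun r x y => smul_mul_assoc r (x : MvPolynomial (Fin (n + 1)) ℂ) y⟩
  have h₁ : Algebra.FiniteType (𝒜 0) (MvPolynomial (Fin (n + 1)) ℂ) :=
    Algebra.FiniteType.of_restrictScalars_finiteType ℂ (𝒜 0) _
  have h₂ : Function.Surjective (algebraMap ℂ (𝒜 0)) := by
    rintro ⟨x, hx⟩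
    have hx' : x ∈ MvPolynomial.homogeneousSubmodule (Fin (n + 1)) ℂ 0 := hx
    rw [MvPolynomial.homogeneousSubmodule_zero, Submodule.mem_one] at hx'
    obtain ⟨r, rfl⟩ := hx'
    exact ⟨r, Subtype.ext rfl⟩
  have h₃ : IsNoetherianRing (CommRingCat.of (𝒜 0)) := isNoetherianRing_of_surjective _ _ _ h₂
  have h₄ : IsLocallyNoetherian (Spec (CommRingCat.of (𝒜 0))) := inferInstance
  have : LocallyOfFiniteType (Proj.toSpecZero 𝒜) := inferInstance
  have h₅ := LocallyOfFiniteType.isLocallyNoetherian (Proj.toSpecZero 𝒜)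
  have : IsLocallyNoetherian (complexProjectiveSpace n) := h₅
  exact LocallyOfFiniteType.isLocallyNoetherian j

/-- If a maximal ideal of a Noetherian ring is minimal over `(a)`, then it is the annihilator of
some class modulo `a`. -/
lemma Ideal.exists_notMem_span_singleton_forall_mul_mem {R : Type*} [CommRing R] [IsNoetherianRing R]
    (𝔪 : Ideal R) {a : R} (h : 𝔪 ∈ (Ideal.span {a}).minimalPrimes) :
    ∃ y, y ∉ Ideal.span {a} ∧ ∀ c ∈ 𝔪, y * c ∈ Ideal.span {a} := by
  have h' : 𝔪 ∈ (Module.annihilator R (R ⧸ Ideal.span {a})).minimalPrimes := by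
    -- Primes minimal over the annihilator of the finite module `R/(a)` are associated primes of it.
    rwa [Ideal.annihilator_quotient]
  have h'' := Module.associatedPrimes.minimalPrimes_annihilator_subset_associatedPrimes R _ h'
  obtain ⟨hp, x, hx⟩ := isAssociatedPrime_iff.1 h''
  obtain ⟨y, rfl⟩ := Ideal.Quotient.mk_surjective x
  refine ⟨y, fun hy => hp.ne_top ?_, fun c hc => ?_⟩
  · rw [hx, Ideal.Quotient.eq_zero_iff_mem.2 hy]
    simp
  · rw [hx, Submodule.mem_colon_singleton, Submodule.mem_bot] at hc
    rw [← Ideal.Quotient.eq_zero_iff_mem, mul_comm]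
    exact hc

namespace AlgebraicGeometry.Scheme

/-- A rational function which is regular at all points of `U` is a section over `U`. -/
lemma exists_germToFunctionField_eq {X : Scheme.{0}} [IsIntegral X] (U : X.Opens) [Nonempty U]
    (g : X.functionField) (hg : ∀ x ∈ U, g ∈ (algebraMap (X.presheaf.stalk x) X.functionField).range) :
    ∃ s : Γ(X, U), X.germToFunctionField U s = g := by
  have H : ∀ x : U, ∃ (V : X.Opens) (_ : V ≤ U) (hV : x.1 ∈ V) (s : Γ(X, V)),
      @germToFunctionField X _ V ⟨⟨x.1, hV⟩⟩ s = g := by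
    intro x
    obtain ⟨r, hr⟩ := hg x.1 x.2
    obtain ⟨V, hxV, s, rfl⟩ := X.presheaf.exists_germ_eq r
    refine ⟨V ⊓ U, inf_le_right, ⟨hxV, x.2⟩, X.presheaf.map (homOfLE inf_le_left).op s, ?_⟩
    have : Nonempty (V ⊓ U : X.Opens) := ⟨⟨x.1, hxV, x.2⟩⟩
    rw [← hr, ← X.algebraMap_germ_eq_germToFunctionField (x := x.1) (U := V ⊓ U) ⟨hxV, x.2⟩]
    congr 1
    exact TopCat.Presheaf.germ_res_apply X.presheaf _ _ _ _
  choose V hVU hxV s hs using H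
  have hη : ∀ x : U, genericPoint X ∈ V x := fun x =>
    ((genericPoint_spec X).mem_open_set_iff (V x).isOpen).2 (by simpa using ⟨x.1, hxV x⟩)
  obtain ⟨t, ht, -⟩ := TopCat.Sheaf.existsUnique_gluing' X.sheaf V U (fun x => homOfLE (hVU x))
    (fun x hx => Opens.mem_iSup.2 ⟨⟨x, hx⟩, hxV _⟩) s (by
      intro x y
      apply germ_injective_of_isIntegral X (genericPoint X) (U := V x ⊓ V y) ⟨hη x, hη y⟩
      exact (TopCat.Presheaf.germ_res_apply X.presheaf _ _ _ _).trans
        (((hs x).trans (hs y).symm).trans (TopCat.Presheaf.germ_res_apply X.presheaf _ _ _ _).symm))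
  obtain ⟨x⟩ := ‹Nonempty U›
  refine ⟨t, (TopCat.Presheaf.germ_res_apply X.presheaf (homOfLE (hVU x)) _ (hη x) t).symm.trans ?_⟩
  rw [← hs x]
  exact congrArg _ (ht x)

/-- On an integral scheme of dimension at most one, the prime of a point of an affine open is
minimal over any nonzero element which it contains. -/
lemma primeIdealOf_mem_minimalPrimes {C : Scheme.{0}} [IsIntegral C] (hC : topologicalKrullDim C ≤ 1)
    {U : C.Opens} (hU : IsAffineOpen U) (p : U) {a : Γ(C, U)} (ha : a ≠ 0)
    (hap : a ∈ (hU.primeIdealOf p).asIdeal) :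
    (hU.primeIdealOf p).asIdeal ∈ (Ideal.span {a}).minimalPrimes := by
  refine ⟨⟨(hU.primeIdealOf p).2, by simpa [Ideal.span_le] using hap⟩, ?_⟩
  rintro q ⟨hq, haq⟩ hqp
  by_contra hpq
  have : Nonempty U := ⟨p⟩
  let q' : PrimeSpectrum Γ(C, U) := ⟨q, hq⟩
  let x : C := hU.fromSpec q'
  have hxp : x ⤳ p.1 := by
    have : q' ⤳ hU.primeIdealOf p := (PrimeSpectrum.le_iff_specializes _ _).1 hqp
    have := this.map hU.fromSpec.continuous
    rwa [hU.fromSpec_primeIdealOf] at this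
  have hx : ¬ p.1 ⤳ x := by
    intro h
    have h1 : x = p.1 := (hxp.antisymm h).eq
    have h2 : q' = hU.primeIdealOf p := by
      apply hU.fromSpec.isOpenEmbedding.injective
      rw [hU.fromSpec_primeIdealOf]; exact h1
    exact hpq (congrArg PrimeSpectrum.asIdeal h2).ge
  have hη : ¬ x ⤳ genericPoint C := by
    intro h
    have h1 : x = genericPoint C := (h.antisymm ((genericPoint_spec C).specializes trivial)).eq
    have h2 : q' = ⊥ := by
      apply hU.fromSpec.isOpenEmbedding.injective
      change x = hU.fromSpec (⊥ : PrimeSpectrum Γ(C, U))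
      have h3 := hU.primeIdealOf_genericPoint
      rw [genericPoint_eq_bot_of_affine] at h3
      rw [← h3, hU.fromSpec_primeIdealOf]
      exact h1
    have h3 : q = ⊥ := congrArg PrimeSpectrum.asIdeal h2
    subst h3
    exact ha (by simpa [Ideal.span_le] using haq)
  let c : C → IrreducibleCloseds C := fun y => ⟨closure {y}, isIrreducible_singleton.closure, isClosed_closure⟩
  have hc : ∀ y z, c y ≤ c z ↔ z ⤳ y := fun y z => specializes_iff_closure_subset.symm
  -- A strictly smaller prime `q` containing `a ≠ 0` would be nonzero, so its point `x` would lie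
  -- strictly between `p` and the generic point. The three closures then form a chain too long for
  -- dimension one.
  let L : LTSeries (IrreducibleCloseds C) :=
    { length := 2
      toFun := ![c p.1, c x, c (genericPoint C)]
      step := by
        intro i
        fin_cases i
        · exact lt_of_le_not_ge ((hc _ _).2 hxp) (fun h => hx ((hc _ _).1 h))
        · exact lt_of_le_not_ge ((hc _ _).2 ((genericPoint_spec C).specializes trivial))
            (fun h => hη ((hc _ _).1 h)) }
  have h1 : ((2 : ℕ) : WithBot ℕ∞) ≤ 1 := (Order.LTSeries.length_le_krullDim L).trans hC
  exact absurd h1 (by decide)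

end AlgebraicGeometry.Scheme

/-! ### The ideal of the scheme-theoretic fiber over a closed point. -/

namespace AlgebraicGeometry

lemma IsAffineOpen.SpecMap_fromSpec_preimage_self {X : Scheme.{0}} {W : X.Opens} (hW : IsAffineOpen W)
    {A : CommRingCat.{0}} (g : Γ(X, W) ⟶ A) : (Spec.map g ≫ hW.fromSpec) ⁻¹ᵁ W = ⊤ := by
  rw [Scheme.Hom.comp_preimage, hW.fromSpec_preimage_self]; rfl

lemma IsAffineOpen.SpecMap_fromSpec_app {X : Scheme.{0}} {W : X.Opens} (hW : IsAffineOpen W)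
    {A : CommRingCat.{0}} (g : Γ(X, W) ⟶ A) :
    (Spec.map g ≫ hW.fromSpec).app W = g ≫ (Scheme.ΓSpecIso A).inv ≫
      (Spec A).presheaf.map (eqToHom (hW.SpecMap_fromSpec_preimage_self g)).op := by
  have h1 := hW.fromSpec_app_of_le W le_rfl
  rw [Scheme.Hom.comp_app, h1]
  simp [← Scheme.ΓSpecIso_inv_naturality_assoc]
  rfl

lemma IsAffineOpen.SpecMap_fromSpec_app_eq_zero_iff {X : Scheme.{0}} {W : X.Opens} (hW : IsAffineOpen W)
    {A : CommRingCat.{0}} (g : Γ(X, W) ⟶ A) (s : Γ(X, W)) :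
    (Spec.map g ≫ hW.fromSpec).app W s = 0 ↔ g s = 0 := by
  rw [hW.SpecMap_fromSpec_app]
  exact map_eq_zero_iff ((Scheme.ΓSpecIso A).inv ≫
      (Spec A).presheaf.map (eqToHom (hW.SpecMap_fromSpec_preimage_self g)).op).hom
    (ConcreteCategory.bijective_of_isIso _).1

lemma IsAffineOpen.SpecMap_evaluation_fromSpec {C : Scheme.{0}} {U : C.Opens} (hU : IsAffineOpen U)
    {p : C} (hp : p ∈ U) :
    Spec.map (C.evaluation U p hp) ≫ hU.fromSpec = C.fromSpecResidueField p := by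
  rw [Scheme.fromSpecResidueField, ← hU.fromSpecStalk_eq_fromSpecStalk hp, fromSpecStalk,
    Scheme.evaluation, Spec.map_comp, Category.assoc]

lemma Scheme.isClosedImmersion_fromSpecResidueField {C : Scheme.{0}} {p : C}
    (hp : IsClosed ({p} : Set C)) : IsClosedImmersion (C.fromSpecResidueField p) :=
  .of_isPreimmersion _ (by rwa [Scheme.range_fromSpecResidueField])

lemma Scheme.Hom.isClosedImmersion_fiberι {X C : Scheme.{0}} (f : X ⟶ C) {p : C}
    (hp : IsClosed ({p} : Set C)) : IsClosedImmersion (f.fiberι p) :=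
  .of_isPreimmersion _ (by
    rw [Scheme.Hom.range_fiberι]
    exact hp.preimage f.continuous)

/-- For a closed point, the inclusion of the spectrum of the residue field is a closed immersion,
hence surjective on sections over affine opens. -/
lemma IsAffineOpen.evaluation_surjective {C : Scheme.{0}} {U : C.Opens} (hU : IsAffineOpen U)
    {p : C} (hp : p ∈ U) (hpc : IsClosed ({p} : Set C)) :
    Function.Surjective (C.evaluation U p hp) := by
  have := Scheme.isClosedImmersion_fromSpecResidueField hpc
  have h := (C.fromSpecResidueField p).app_surjective U hU
  rw [← hU.SpecMap_evaluation_fromSpec hp, hU.SpecMap_fromSpec_app] at h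
  intro y
  obtain ⟨x, hx⟩ := h (((Scheme.ΓSpecIso (C.residueField p)).inv ≫ (Spec (C.residueField p)).presheaf.map
    (eqToHom (hU.SpecMap_fromSpec_preimage_self (C.evaluation U p hp))).op) y)
  exact ⟨x, (ConcreteCategory.bijective_of_isIso ((Scheme.ΓSpecIso (C.residueField p)).inv ≫
    (Spec (C.residueField p)).presheaf.map
      (eqToHom (hU.SpecMap_fromSpec_preimage_self (C.evaluation U p hp))).op)).1 hx⟩

namespace Scheme.Hom

variable {X C : Scheme.{0}} (f : X ⟶ C) {p : C} {U : C.Opens} (hU : IsAffineOpen U) (hp : p ∈ U)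

include hU

/-- The composite from the fiber to `C` factors through the spectrum of the residue field at `p`. -/
lemma fiberι_app_app_eq_zero {c : Γ(C, U)} (hc : C.evaluation U p hp c = 0) :
    (f.fiberι p).app (f ⁻¹ᵁ U) (f.app U c) = 0 := by
  have h1 : (C.fromSpecResidueField p).app U c = 0 := by
    rw [← hU.SpecMap_evaluation_fromSpec hp, hU.SpecMap_fromSpec_app_eq_zero_iff, hc]
  have h2 : (f.fiberι p ≫ f).app U c = 0 := by
    rw [f.fiber_fac p]
    exact (congrArg ((f.fiberToSpecResidueField p).app _).hom h1).trans (map_zero _)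
  exact h2

/-- The ideal of the fiber over a closed point `p` is generated by the functions vanishing
at `p`. -/
lemma mem_map_ker_of_fiberι_app_eq_zero (hpc : IsClosed ({p} : Set C))
    {W : X.Opens} (hW : IsAffineOpen W) (hWU : W ≤ f ⁻¹ᵁ U) (s : Γ(X, W))
    (hs : (f.fiberι p).app W s = 0) :
    s ∈ (RingHom.ker (C.evaluation U p hp).hom).map (f.appLE U W hWU).hom := by
  set J := (RingHom.ker (C.evaluation U p hp).hom).map (f.appLE U W hWU).hom with hJ
  -- The spectrum of `Γ(X, W)/J` serves as a test scheme. Functions vanishing at `p` die in this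
  -- quotient, so it lies over the residue field and maps to the fiber by the universal property. A
  -- function vanishing on the fiber therefore vanishes in the quotient.
  let q : Γ(X, W) ⟶ CommRingCat.of (Γ(X, W) ⧸ J) := CommRingCat.ofHom (Ideal.Quotient.mk J)
  have hsurj := hU.evaluation_surjective hp hpc
  have hker : RingHom.ker (C.evaluation U p hp).hom ≤ RingHom.ker (f.appLE U W hWU ≫ q).hom :=
    fun c hc => Ideal.Quotient.eq_zero_iff_mem.2 (Ideal.mem_map_of_mem _ hc)
  let k : C.residueField p ⟶ CommRingCat.of (Γ(X, W) ⧸ J) := CommRingCat.ofHom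
    ((C.evaluation U p hp).hom.liftOfSurjective hsurj ⟨(f.appLE U W hWU ≫ q).hom, hker⟩)
  have hk : C.evaluation U p hp ≫ k = f.appLE U W hWU ≫ q := by
    ext c
    exact RingHom.liftOfRightInverse_comp_apply (C.evaluation U p hp).hom _
      (Function.rightInverse_surjInv hsurj) ⟨(f.appLE U W hWU ≫ q).hom, hker⟩ c
  have hcomm : (Spec.map q ≫ hW.fromSpec) ≫ f = Spec.map k ≫ C.fromSpecResidueField p := by
    rw [← hU.SpecMap_evaluation_fromSpec hp, ← Spec.map_comp_assoc, hk, Spec.map_comp_assoc,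
      IsAffineOpen.SpecMap_appLE_fromSpec f hU hW hWU, Category.assoc]
  let l : Spec _ ⟶ f.fiber p := Limits.pullback.lift _ _ hcomm
  have hl : l ≫ f.fiberι p = Spec.map q ≫ hW.fromSpec := Limits.pullback.lift_fst _ _ _
  have h0 : (l ≫ f.fiberι p).app W s = 0 :=
    (congrArg (l.app _).hom hs).trans (map_zero _)
  rw [hl, hW.SpecMap_fromSpec_app_eq_zero_iff] at h0
  exact Ideal.Quotient.eq_zero_iff_mem.1 h0

end Scheme.Hom

end AlgebraicGeometry

/-! ### A single rational equation for the divisor near the fiber. -/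

namespace AlgebraicGeometry.Scheme

variable {X : Scheme.{0}} [IsIntegral X]

lemma mk_eq_mk_iff {x : X} {φ ψ : (X.functionField)ˣ} :
    (QuotientGroup.mk φ : (X.functionField)ˣ ⧸ X.stalkUnits x) = QuotientGroup.mk ψ ↔
      ∃ u : (X.presheaf.stalk x)ˣ,
        algebraMap (X.presheaf.stalk x) X.functionField u * φ = ψ := by
  rw [QuotientGroup.eq]
  constructor
  · rintro ⟨u, hu⟩
    refine ⟨u, ?_⟩
    have := congrArg Units.val hu
    simp only [Units.val_mul, Units.coe_map] at this
    change algebraMap (X.presheaf.stalk x) X.functionField u = _ at this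
    rw [this, mul_comm, ← mul_assoc, Units.mul_inv, one_mul]
  · rintro ⟨u, hu⟩
    refine ⟨u, Units.ext ?_⟩
    change algebraMap (X.presheaf.stalk x) X.functionField u = _
    rw [Units.val_mul, ← hu, mul_comm (algebraMap _ _ _), ← mul_assoc, Units.inv_mul, one_mul]

namespace CartierDivisor

lemma germ_neg (D : X.CartierDivisor) (x : X) : (-D).germ x = (D.germ x)⁻¹ := rfl

lemma germ_add (D E : X.CartierDivisor) (x : X) : (D + E).germ x = D.germ x * E.germ x := rfl

lemma germ_nsmul (D : X.CartierDivisor) (k : ℕ) (x : X) : (k • D).germ x = D.germ x ^ k := rfl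

/-- It suffices to test membership in `𝒪_X(D)_x` on one local equation. -/
lemma memStalk_iff {D : X.CartierDivisor} {x : X} {φ : (X.functionField)ˣ}
    (hφ : QuotientGroup.mk φ = D.germ x) (g : X.functionField) :
    D.MemStalk x g ↔ g * φ ∈ (algebraMap (X.presheaf.stalk x) X.functionField).range := by
  refine ⟨fun h => h φ hφ, fun h ψ hψ => ?_⟩
  obtain ⟨u, hu⟩ := mk_eq_mk_iff.1 (hφ.trans hψ.symm)
  rw [← hu, mul_left_comm]
  exact mul_mem ⟨u, rfl⟩ h

lemma exists_germ_eq (D : X.CartierDivisor) (x : X) :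
    ∃ φ : (X.functionField)ˣ, QuotientGroup.mk φ = D.germ x :=
  QuotientGroup.mk_surjective (D.germ x)

end CartierDivisor

section LocalParameter

variable {C : Scheme.{0}} (f : X ⟶ C) {p : C} {F : X.CartierDivisor}
  {U : C.Opens} (hU : IsAffineOpen U) (hpU : p ∈ U) [Nonempty (f ⁻¹ᵁ U)]

/-- The pullback of functions on an open subset to rational functions on the source. -/
def Hom.pullbackToFunctionField (U : C.Opens) [Nonempty (f ⁻¹ᵁ U)] : Γ(C, U) →+* X.functionField :=
  (X.germToFunctionField (f ⁻¹ᵁ U)).hom.comp (f.app U).hom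

lemma Hom.pullbackToFunctionField_eq (c : Γ(C, U)) {x : X} (hx : f x ∈ U) :
    f.pullbackToFunctionField U c = algebraMap (X.presheaf.stalk x) X.functionField
      (X.presheaf.germ (f ⁻¹ᵁ U) x hx (f.app U c)) :=
  (X.algebraMap_germ_eq_germToFunctionField (U := f ⁻¹ᵁ U) hx _).symm

lemma Hom.pullbackToFunctionField_appLE (c : Γ(C, U)) {W : X.Opens} [Nonempty W] (hW : W ≤ f ⁻¹ᵁ U) :
    X.germToFunctionField W (f.appLE U W hW c) = f.pullbackToFunctionField U c := by
  rw [Scheme.Hom.appLE, CommRingCat.comp_apply]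
  exact TopCat.Presheaf.germ_res_apply X.presheaf _ _ _ _

include hU

/-- This is the inclusion `𝔪 𝒪_X ⊆ 𝒪_X(-F)` at `x`: pulled back functions vanishing at `p` vanish on
the fiber. -/
lemma exists_pullbackToFunctionField_eq_mul (hF : F.IsDivisorOf (f.fiberι p))
    {c : Γ(C, U)} (hc : C.evaluation U p hpU c = 0) {x : X} (hx : f x ∈ U)
    {φ : (X.functionField)ˣ} (hφ : QuotientGroup.mk φ = F.germ x) :
    ∃ r : X.presheaf.stalk x,
      f.pullbackToFunctionField U c = algebraMap (X.presheaf.stalk x) X.functionField r * φ := by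
  obtain ⟨r, hr⟩ := (hF (f ⁻¹ᵁ U) (f.pullbackToFunctionField U c)).2
    ⟨f.app U c, f.fiberι_app_app_eq_zero hU hpU hc, rfl⟩ x hx φ⁻¹ (by
      rw [CartierDivisor.germ_neg, ← hφ]; rfl)
  refine ⟨r, ?_⟩
  rw [hr, mul_assoc, Units.inv_mul, mul_one]

/-- This is the reverse inclusion `𝒪_X(-F) ⊆ 𝔪 𝒪_X` at `x`. A local equation on a small affine open
vanishes on the fiber, so `mem_map_ker_of_fiberι_app_eq_zero` applies to it. -/
lemma mem_span_pullbackToFunctionField (hpc : IsClosed ({p} : Set C))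
    (hF : F.IsDivisorOf (f.fiberι p)) {x : X} (hx : f x ∈ U)
    {φ : (X.functionField)ˣ} (hφ : QuotientGroup.mk φ = F.germ x) :
    (φ : X.functionField) ∈ Submodule.span (X.presheaf.stalk x)
      (f.pullbackToFunctionField U '' {c | C.evaluation U p hpU c = 0}) := by
  obtain ⟨W₀, hxW₀, ψ, hψ⟩ := (Additive.toMul F).2 x
  obtain ⟨W, hW, hxW, hWle⟩ :=
    Opens.isBasis_iff_nbhd.mp X.isBasis_affineOpens (show x ∈ W₀ ⊓ f ⁻¹ᵁ U from ⟨hxW₀, hx⟩)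
  have : Nonempty W := ⟨⟨x, hxW⟩⟩
  have hψ' : ∀ y ∈ W, QuotientGroup.mk ψ = F.germ y := fun y hy => (hψ y (hWle hy).1).symm
  obtain ⟨s, hs, hsψ⟩ := (hF W ψ).1 (fun y hy =>
    (CartierDivisor.memStalk_iff (φ := ψ⁻¹) (by
      rw [CartierDivisor.germ_neg, ← hψ' y hy]; rfl) _).2 ⟨1, by rw [map_one, Units.mul_inv]⟩)
  have hWU : W ≤ f ⁻¹ᵁ U := hWle.trans inf_le_right
  have hsJ := f.mem_map_ker_of_fiberι_app_eq_zero hU hpU hpc hW hWU s hs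
  have key : ∀ s ∈ (RingHom.ker (C.evaluation U p hpU).hom).map (f.appLE U W hWU).hom,
      X.germToFunctionField W s ∈ Submodule.span (X.presheaf.stalk x)
        (f.pullbackToFunctionField U '' {c | C.evaluation U p hpU c = 0}) := by
    intro s hs
    refine Submodule.span_induction ?_ ?_ ?_ ?_ hs
    · rintro _ ⟨c, hc, rfl⟩
      exact Submodule.subset_span ⟨c, hc, (f.pullbackToFunctionField_appLE c hWU).symm⟩
    · rw [map_zero]; exact zero_mem _
    · intro a b _ _ ha hb
      rw [map_add]; exact add_mem ha hb
    · intro r a _ ha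
      rw [smul_eq_mul, map_mul, ← X.algebraMap_germ_eq_germToFunctionField hxW r, ← Algebra.smul_def]
      exact Submodule.smul_mem _ _ ha
  obtain ⟨u, hu⟩ := mk_eq_mk_iff.1 ((hψ' x hxW).trans hφ.symm)
  rw [← hu, ← Algebra.smul_def, ← hsψ]
  exact Submodule.smul_mem _ _ (key s hsJ)

end LocalParameter

/-- If `f : X ⟶ C` is a morphism to a curve with `𝒪_C = f_* 𝒪_X`, and the fiber over the closed
point `p` is a Cartier divisor, then it is given by one rational function in a neighborhood. -/
theorem CartierDivisor.IsDivisorOf.exists_equation_near_fiber {C : Scheme.{0}} [IsIntegral C]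
    [IsLocallyNoetherian C] (hC : topologicalKrullDim C ≤ 1) (f : X ⟶ C)
    (hf : Function.Surjective f) (hiso : ∀ U : C.Opens, IsIso (f.app U)) {p : C}
    (hp : IsClosed ({p} : Set C)) {F : X.CartierDivisor} (hF : F.IsDivisorOf (f.fiberι p)) :
    ∃ V : X.Opens, (∀ x, f x = p → x ∈ V) ∧ ∃ t : (X.functionField)ˣ,
      ∀ x ∈ V, QuotientGroup.mk t = F.germ x := by
  obtain ⟨U, hU, hpU, -⟩ :=
    Opens.isBasis_iff_nbhd.mp C.isBasis_affineOpens (show p ∈ (⊤ : C.Opens) from trivial)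
  obtain ⟨x₀, hx₀⟩ := hf p
  have hne : Nonempty (f ⁻¹ᵁ U) := ⟨⟨x₀, by rw [Scheme.Hom.mem_preimage, hx₀]; exact hpU⟩⟩
  have hneU : Nonempty U := ⟨⟨p, hpU⟩⟩
  have hnoeth : IsNoetherianRing Γ(C, U) := IsLocallyNoetherian.component_noetherian ⟨U, hU⟩
  set σ := f.pullbackToFunctionField U with hσ
  have hσinj : Function.Injective σ :=
    (X.germToFunctionField_injective _).comp (ConcreteCategory.bijective_of_isIso (f.app U)).1
  let 𝔪 : Ideal Γ(C, U) := RingHom.ker (C.evaluation U p hpU).hom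
  have h𝔪 : 𝔪 = (hU.primeIdealOf ⟨p, hpU⟩).asIdeal := by
    ext c
    rw [hU.primeIdealOf_eq_map_closedPoint]
    exact IsLocalRing.residue_eq_zero_iff _
  have hi := fun (x : X) (hx : f x ∈ U) (φ : (X.functionField)ˣ) (hφ : QuotientGroup.mk φ = F.germ x)
    (c : Γ(C, U)) (hc : c ∈ 𝔪) => exists_pullbackToFunctionField_eq_mul f hU hpU hF hc hx hφ
  have hii := fun (x : X) (hx : f x ∈ U) (φ : (X.functionField)ˣ)
    (hφ : QuotientGroup.mk φ = F.germ x) => mem_span_pullbackToFunctionField f hU hpU hp hF hx hφ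
  -- If `𝔪` were zero, the local equation of `F` at `x₀`, which lies in the span of the pullback of
  -- `𝔪`, would be zero.
  obtain ⟨a, ha𝔪, ha⟩ : ∃ a ∈ 𝔪, a ≠ 0 := by
    by_contra! h
    obtain ⟨φ, hφ⟩ := F.exists_germ_eq x₀
    have h1 := hii x₀ (by rwa [hx₀]) φ hφ
    refine φ.ne_zero ((Submodule.span_eq_bot.2 ?_).le h1)
    rintro _ ⟨c, hc, rfl⟩
    rw [h c hc, map_zero]
  obtain ⟨y, hy, hya⟩ := 𝔪.exists_notMem_span_singleton_forall_mul_mem (a := a) (by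
    rw [h𝔪]
    exact primeIdealOf_mem_minimalPrimes hC hU ⟨p, hpU⟩ ha (by rwa [← h𝔪]))
  simp only [Ideal.mem_span_singleton'] at hy hya
  have hσa : σ a ≠ 0 := by rwa [Ne, map_eq_zero_iff σ hσinj]
  -- Multiplication by `y/a` sends `𝔪` into `Γ(C, U)`; the question is whether it stays inside `𝔪`.
  by_cases hcase : ∀ c ∈ 𝔪, ∀ d, d * a = y * c → d ∈ 𝔪
  · exfalso
    -- Here `y/a` preserves the span of `𝔪` in each stalk. That span is generated by the nonzero
    -- element `φ`, so `y/a` is itself regular. It then descends to `U` through `f_* 𝒪_X = 𝒪_C`,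
    -- contradicting `y ∉ (a)`.
    obtain ⟨s, hs⟩ := exists_germToFunctionField_eq (f ⁻¹ᵁ U) (σ y / σ a) (fun x hx => by
      obtain ⟨φ, hφ⟩ := F.exists_germ_eq x
      have h1 : σ y / σ a * φ ∈ Submodule.span (X.presheaf.stalk x) (σ '' 𝔪) := by
        have := hii x hx φ hφ
        refine Submodule.span_induction (p := fun v _ => σ y / σ a * v ∈
          Submodule.span (X.presheaf.stalk x) (σ '' 𝔪)) ?_ ?_ ?_ ?_ this
        · rintro _ ⟨c, hc, rfl⟩
          obtain ⟨d, hd⟩ := hya c hc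
          refine Submodule.subset_span ⟨d, hcase c hc d hd, ?_⟩
          rw [div_mul_eq_mul_div, ← map_mul, ← hd, map_mul, mul_div_assoc, div_self hσa, mul_one]
        · rw [mul_zero]; exact zero_mem _
        · intro v w _ _ hv hw
          rw [mul_add]; exact add_mem hv hw
        · intro r v _ hv
          rw [mul_smul_comm]; exact Submodule.smul_mem _ _ hv
      have h2 : Submodule.span (X.presheaf.stalk x) (σ '' 𝔪) ≤
          Submodule.span (X.presheaf.stalk x) {(φ : X.functionField)} := by
        rw [Submodule.span_le]
        rintro _ ⟨c, hc, rfl⟩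
        obtain ⟨r, hr⟩ := hi x hx φ hφ c hc
        exact Submodule.mem_span_singleton.2 ⟨r, by rw [Algebra.smul_def]; exact hr.symm⟩
      obtain ⟨r, hr⟩ := Submodule.mem_span_singleton.1 (h2 h1)
      rw [Algebra.smul_def] at hr
      exact ⟨r, mul_right_cancel₀ φ.ne_zero hr⟩)
    obtain ⟨c, rfl⟩ := (ConcreteCategory.bijective_of_isIso (f.app U)).2 s
    refine hy ⟨c, hσinj ?_⟩
    rw [map_mul, show σ c = σ y / σ a from hs, div_mul_cancel₀ _ hσa]
  · push Not at hcase
    obtain ⟨c, hc, d, hd, hd𝔪⟩ := hcase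
    have hc0 : c ≠ 0 := by
      rintro rfl
      rw [mul_zero, mul_eq_zero, or_iff_left ha] at hd
      exact hd𝔪 (hd ▸ 𝔪.zero_mem)
    have hσc : σ c ≠ 0 := by rwa [Ne, map_eq_zero_iff σ hσinj]
    -- The function `d = yc/a` does not vanish at `p`, and `c` generates `𝔪` wherever `d` is
    -- invertible.
    refine ⟨f ⁻¹ᵁ C.basicOpen d, fun x hx => ?_, Units.mk0 (σ c) hσc, fun x hx => ?_⟩
    · rw [Scheme.Hom.mem_preimage, hx, ← C.evaluation_ne_zero_iff_mem_basicOpen p hpU]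
      exact hd𝔪
    · have hxU : f x ∈ U := C.basicOpen_le d hx
      obtain ⟨φ, hφ⟩ := F.exists_germ_eq x
      obtain ⟨r, hr⟩ := hi x hxU φ hφ c hc
      obtain ⟨u, hu⟩ : ∃ u : (X.presheaf.stalk x)ˣ,
          σ d = algebraMap (X.presheaf.stalk x) X.functionField u := by
        have hx' : x ∈ X.basicOpen (f.app U d) := by rwa [← Scheme.preimage_basicOpen]
        obtain ⟨u, hu⟩ := (X.mem_basicOpen (f.app U d) x hxU).1 hx'
        exact ⟨u, by rw [hu]; exact f.pullbackToFunctionField_eq d hxU⟩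
      have h2 : Submodule.span (X.presheaf.stalk x) (σ '' 𝔪) ≤
          Submodule.span (X.presheaf.stalk x) {σ c} := by
        rw [Submodule.span_le]
        rintro _ ⟨e, he, rfl⟩
        obtain ⟨e', he'⟩ := hya e he
        -- Both sides become `yce` after multiplication by `a`.
        have h3 : d * e = c * e' := by
          apply mul_right_cancel₀ ha
          linear_combination e * hd - c * he'
        refine Submodule.mem_span_singleton.2 ⟨X.presheaf.germ (f ⁻¹ᵁ U) x hxU (f.app U e') * ↑u⁻¹, ?_⟩
        rw [Algebra.smul_def, map_mul, ← f.pullbackToFunctionField_eq e' hxU, ← hσ, mul_right_comm,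
          ← map_mul, mul_comm e', ← h3, map_mul, hu, mul_right_comm, ← map_mul, Units.mul_inv,
          map_one, one_mul]
      obtain ⟨r', hr'⟩ := Submodule.mem_span_singleton.1 (h2 (hii x hxU φ hφ))
      rw [Algebra.smul_def] at hr'
      rw [← hφ, mk_eq_mk_iff]
      have h4 : r' * r = 1 := by
        apply IsFractionRing.injective (X.presheaf.stalk x) X.functionField
        apply mul_right_cancel₀ φ.ne_zero
        rw [map_mul, mul_assoc, ← hr, map_one, one_mul]
        exact hr'
      exact ⟨⟨r', r, h4, mul_comm r r' ▸ h4⟩, hr'⟩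

end AlgebraicGeometry.Scheme

/-! ### Local sections of the pullback of a module along an immersion. -/

namespace AlgebraicGeometry.Scheme

/-- Sections over a locally closed subscheme lift locally. -/
lemma Hom.exists_app_eq {Z X : Scheme.{0}} (i : Z ⟶ X) [IsPreimmersion i] {V : Z.Opens} (r : Γ(Z, V))
    {z : Z} (hz : z ∈ V) :
    ∃ (W : X.Opens) (h : i ⁻¹ᵁ W ≤ V), i z ∈ W ∧ ∃ r' : Γ(X, W),
      i.app W r' = Z.presheaf.map (homOfLE h).op r := by
  obtain ⟨g, hg⟩ := i.stalkMap_surjective z (Z.presheaf.germ V z hz r)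
  obtain ⟨W₁, hzW₁, r₁, rfl⟩ := X.presheaf.exists_germ_eq g
  rw [Scheme.Hom.germ_stalkMap_apply] at hg
  obtain ⟨V₂, hzV₂, a, b, hab⟩ := Z.presheaf.germ_eq z _ _ _ _ hg
  obtain ⟨W₂, hW₂, hWV₂⟩ := i.isEmbedding.isInducing.isOpen_iff.1 V₂.isOpen
  have hle : i ⁻¹ᵁ (W₁ ⊓ ⟨W₂, hW₂⟩) ≤ V₂ := fun y hy => by
    have : y ∈ i ⁻¹' W₂ := hy.2
    rw [hWV₂] at this; exact this
  have hzW₂ : i z ∈ W₂ := by rw [← Set.mem_preimage, hWV₂]; exact hzV₂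
  refine ⟨W₁ ⊓ ⟨W₂, hW₂⟩, hle.trans b.le, ⟨hzW₁, hzW₂⟩,
    X.presheaf.map (homOfLE inf_le_left).op r₁, ?_⟩
  have h1 : i.app (W₁ ⊓ ⟨W₂, hW₂⟩) (X.presheaf.map (homOfLE inf_le_left).op r₁) =
      Z.presheaf.map ((Opens.map i.base).map (homOfLE inf_le_left)).op (i.app W₁ r₁) :=
    ConcreteCategory.congr_hom (i.naturality (homOfLE (inf_le_left : W₁ ⊓ ⟨W₂, hW₂⟩ ≤ W₁)).op) r₁
  rw [h1]
  have h2 := congrArg (Z.presheaf.map (homOfLE hle).op) hab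
  have h3 := ConcreteCategory.congr_hom (Z.presheaf.map_comp a.op (homOfLE hle).op) (i.app W₁ r₁)
  have h4 := ConcreteCategory.congr_hom (Z.presheaf.map_comp b.op (homOfLE hle).op) r
  exact h3.trans (h2.trans h4.symm)

namespace Modules

lemma map_map {X : Scheme.{0}} (M : X.Modules) {U V W : X.Opens} (i : U ⟶ V) (j : V ⟶ W) (k : U ⟶ W)
    (s : Γ(M, W)) : M.presheaf.map i.op (M.presheaf.map j.op s) = M.presheaf.map k.op s := by
  rw [show k = i ≫ j from rfl, op_comp, Functor.map_comp]; rfl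

lemma Hom.app_map {X : Scheme.{0}} {M N : X.Modules} (φ : M ⟶ N) {U V : X.Opens} (i : U ⟶ V)
    (s : Γ(M, V)) : φ.app U (M.presheaf.map i.op s) = N.presheaf.map i.op (φ.app V s) :=
  ConcreteCategory.congr_hom (φ.mapPresheaf.naturality i.op) s

/-- A subsheaf of a sheaf of modules, given by a submodule of the underlying presheaf which is
defined by a local condition. -/
def ofSubmodule {X : Scheme.{0}} (M : X.Modules) (P : PresheafOfModules.Submodule M.val)
    (hP : ∀ (U : X.Opens) (s : Γ(M, U)), (∀ x ∈ U, ∃ (V : X.Opens) (i : V ⟶ U), x ∈ V ∧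
      M.presheaf.map i.op s ∈ P.obj (op V)) → s ∈ P.obj (op U)) : X.Modules where
  val := P.toPresheafOfModules
  isSheaf := by
    refine (TopCat.Presheaf.isSheaf_iff_isSheaf_comp (CategoryTheory.forget AddCommGrpCat) _).2 ?_
    refine TopCat.Presheaf.isSheaf_of_isSheafUniqueGluing_types _ ?_
    intro ι U sf hsf
    let t : ∀ i, P.obj (op (U i)) := sf
    obtain ⟨s, hs, hs'⟩ := TopCat.Sheaf.existsUnique_gluing
      (⟨M.presheaf, M.isSheaf⟩ : TopCat.Sheaf AddCommGrpCat X) U (fun i => (t i).1)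
      (fun i j => congrArg Subtype.val (hsf i j))
    refine ⟨(⟨s, hP _ s fun x hx => ?_⟩ : P.obj (op (iSup U))), fun i => Subtype.ext (hs i),
      fun s' hs'' => Subtype.ext (hs' _ fun i => congrArg Subtype.val (hs'' i))⟩
    obtain ⟨i, hi⟩ := Opens.mem_iSup.1 hx
    refine ⟨U i, Opens.leSupr U i, hi, ?_⟩
    have : M.presheaf.map (Opens.leSupr U i).op s = (t i).1 := hs i
    rw [this]
    exact (t i).2

/-- The unit `M ⟶ i_* i^* M`. -/
abbrev unit {Z X : Scheme.{0}} (i : Z ⟶ X) (M : X.Modules) :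
    M ⟶ (pushforward i).obj ((pullback i).obj M) :=
  (pullbackPushforwardAdjunction i).unit.app M

/-- The section `s` of `i^* M` is locally pulled back from sections of `M`. -/
def IsLocallyPulledBack {Z X : Scheme.{0}} (i : Z ⟶ X) (M : X.Modules) (V : Z.Opens)
    (s : Γ((pullback i).obj M, V)) : Prop :=
  ∀ z ∈ V, ∃ (W : X.Opens) (h : i ⁻¹ᵁ W ≤ V), i z ∈ W ∧ ∃ m : Γ(M, W), (unit i M).app W m =
    ((pullback i).obj M).presheaf.map (homOfLE h).op s

section

variable {Z X : Scheme.{0}} (i : Z ⟶ X) (M : X.Modules)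

lemma unit_app_map {W W' : X.Opens} (j : W' ≤ W) (m : Γ(M, W)) :
    (unit i M).app W' (M.presheaf.map (homOfLE j).op m) =
      ((pullback i).obj M).presheaf.map (homOfLE (i.preimage_mono j)).op ((unit i M).app W m) :=
  Hom.app_map (unit i M) (homOfLE j) m

variable {i M}

lemma unit_app_map_eq {V : Z.Opens} {s : Γ((pullback i).obj M, V)} {W W' : X.Opens}
    {h : i ⁻¹ᵁ W ≤ V} {m : Γ(M, W)}
    (hm : (unit i M).app W m = ((pullback i).obj M).presheaf.map (homOfLE h).op s) (j : W' ≤ W) :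
    (unit i M).app W' (M.presheaf.map (homOfLE j).op m) =
      ((pullback i).obj M).presheaf.map (homOfLE ((i.preimage_mono j).trans h)).op s := by
  rw [unit_app_map, hm]
  exact map_map _ _ _ _ _

lemma IsLocallyPulledBack.add {V : Z.Opens} {s t : Γ((pullback i).obj M, V)}
    (hs : IsLocallyPulledBack i M V s) (ht : IsLocallyPulledBack i M V t) :
    IsLocallyPulledBack i M V (s + t) := fun z hz => by
  obtain ⟨W, h, hzW, m, hm⟩ := hs z hz
  obtain ⟨W', h', hzW', m', hm'⟩ := ht z hz
  refine ⟨W ⊓ W', (i.preimage_mono inf_le_left).trans h, ⟨hzW, hzW'⟩,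
    M.presheaf.map (homOfLE inf_le_left).op m + M.presheaf.map (homOfLE inf_le_right).op m', ?_⟩
  exact (map_add _ _ _).trans ((congrArg₂ (· + ·) (unit_app_map_eq hm inf_le_left)
    (unit_app_map_eq hm' inf_le_right)).trans (map_add _ _ _).symm)

/-- For an immersion the scalars on `Z` also lift locally to `X`. -/
lemma IsLocallyPulledBack.smul [IsPreimmersion i] {V : Z.Opens} {s : Γ((pullback i).obj M, V)}
    (hs : IsLocallyPulledBack i M V s) (r : Γ(Z, V)) :
    IsLocallyPulledBack i M V (r • s) := fun z hz => by
  obtain ⟨W, h, hzW, m, hm⟩ := hs z hz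
  obtain ⟨W', h', hzW', r', hr'⟩ := i.exists_app_eq r hz
  refine ⟨W ⊓ W', (i.preimage_mono inf_le_left).trans h, ⟨hzW, hzW'⟩,
    X.presheaf.map (homOfLE (inf_le_right : W ⊓ W' ≤ W')).op r' •
      M.presheaf.map (homOfLE (inf_le_left : W ⊓ W' ≤ W)).op m, ?_⟩
  have h1 : i.app (W ⊓ W') (X.presheaf.map (homOfLE inf_le_right).op r') =
      Z.presheaf.map (homOfLE ((i.preimage_mono inf_le_left).trans h)).op r := by
    refine (ConcreteCategory.congr_hom
      (i.naturality (homOfLE (inf_le_right : W ⊓ W' ≤ W')).op) r').trans ?_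
    refine (congrArg (Z.presheaf.map _) hr').trans ?_
    exact (ConcreteCategory.congr_hom (Z.presheaf.map_comp _ _) r).symm
  rw [map_smul, ← h1, ← unit_app_map_eq hm inf_le_left, Hom.app_smul]
  rfl

lemma IsLocallyPulledBack.map {V V' : Z.Opens} {s : Γ((pullback i).obj M, V)}
    (hi : Topology.IsInducing i) (hs : IsLocallyPulledBack i M V s) (j : V' ⟶ V) :
    IsLocallyPulledBack i M V' (((pullback i).obj M).presheaf.map j.op s) := fun z hz => by
  obtain ⟨W, h, hzW, m, hm⟩ := hs z (j.le hz)
  obtain ⟨W', hW', hWV'⟩ := hi.isOpen_iff.1 V'.isOpen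
  have hle : i ⁻¹ᵁ (W ⊓ ⟨W', hW'⟩) ≤ V' := fun y hy => by
    have : y ∈ i ⁻¹' W' := hy.2
    rw [hWV'] at this; exact this
  have hzW' : i z ∈ W' := by rw [← Set.mem_preimage, hWV']; exact hz
  refine ⟨W ⊓ ⟨W', hW'⟩, hle, ⟨hzW, hzW'⟩, M.presheaf.map (homOfLE inf_le_left).op m, ?_⟩
  rw [unit_app_map_eq hm inf_le_left]
  exact (map_map _ _ _ _ _).symm

lemma IsLocallyPulledBack.of_local {V : Z.Opens} {s : Γ((pullback i).obj M, V)}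
    (hs : ∀ z ∈ V, ∃ (V' : Z.Opens) (j : V' ⟶ V), z ∈ V' ∧
      IsLocallyPulledBack i M V' (((pullback i).obj M).presheaf.map j.op s)) :
    IsLocallyPulledBack i M V s := fun z hz => by
  obtain ⟨V', j, hzV', h'⟩ := hs z hz
  obtain ⟨W, h, hzW, m, hm⟩ := h' z hzV'
  exact ⟨W, h.trans j.le, hzW, m, hm.trans (map_map _ _ _ _ _)⟩

lemma isLocallyPulledBack_unit {W : X.Opens} (m : Γ(M, W)) :
    IsLocallyPulledBack i M (i ⁻¹ᵁ W) ((unit i M).app W m) := fun z hz => by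
  refine ⟨W, le_rfl, hz, m, ?_⟩
  have := ((pullback i).obj M).presheaf.map_id (op (i ⁻¹ᵁ W))
  exact (ConcreteCategory.congr_hom this _).symm

end

/-- The sections of `i^* M` which are locally pulled back from sections of `M`. -/
def imageOfUnit {Z X : Scheme.{0}} (i : Z ⟶ X) [IsPreimmersion i] (M : X.Modules) :
    PresheafOfModules.Submodule ((pullback i).obj M).val where
  obj V :=
    { carrier := {s : Γ((pullback i).obj M, V.unop) | IsLocallyPulledBack i M V.unop s}
      zero_mem' := fun z hz => by
        obtain ⟨W, h, hzW, -⟩ := i.exists_app_eq (0 : Γ(Z, V.unop)) hz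
        exact ⟨W, h, hzW, 0, (map_zero _).trans (map_zero _).symm⟩
      add_mem' := fun hs ht => hs.add ht
      smul_mem' := fun r _ hs => hs.smul r }
  map j _ hs := IsLocallyPulledBack.map i.isEmbedding.isInducing hs j.unop

/-- Sections of `i^* M` are locally pulled back from sections of `M`, for an immersion `i`. -/
theorem isLocallyPulledBack {Z X : Scheme.{0}} (i : Z ⟶ X) [IsPreimmersion i] (M : X.Modules)
    {V : Z.Opens} (s : Γ((pullback i).obj M, V)) : IsLocallyPulledBack i M V s := by
  -- The unit factors through the direct image of the subsheaf `N`. The adjoint of this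
  -- factorization, followed by the inclusion, is the identity of `i^* M`, so `N` is everything.
  let N := ((pullback i).obj M).ofSubmodule (imageOfUnit i M)
    (fun _ _ hs => IsLocallyPulledBack.of_local hs)
  let inc : N ⟶ (pullback i).obj M := ⟨(imageOfUnit i M).ι⟩
  let θ : M ⟶ (pushforward i).obj N := ⟨PresheafOfModules.homMk
    { app := fun W => AddCommGrpCat.ofHom
        (Y := AddCommGrpCat.of ((imageOfUnit i M).obj (op (i ⁻¹ᵁ W.unop))))
        { toFun := fun m => ⟨(unit i M).app W.unop m, isLocallyPulledBack_unit m⟩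
          map_zero' := Subtype.ext (map_zero ((unit i M).app W.unop).hom)
          map_add' := fun a b => Subtype.ext (map_add ((unit i M).app W.unop).hom a b) }
      naturality := fun W W' j => by
        ext m
        exact Subtype.ext (Hom.app_map (unit i M) j.unop m) }
    fun W r m => Subtype.ext (Hom.app_smul (unit i M) (U := W.unop) r m)⟩
  have h1 : θ ≫ (pushforward i).map inc = unit i M := by
    ext W m
    rfl
  have h2 : ((pullbackPushforwardAdjunction i).homEquiv M N).symm θ ≫ inc = 𝟙 _ := by
    rw [← Adjunction.homEquiv_naturality_right_symm, h1, Equiv.symm_apply_eq,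
      Adjunction.homEquiv_id]
  have h3 := congrArg (fun φ => Hom.app φ V s) h2
  have h4 : (imageOfUnit i M).ι.app (op V)
    ((((pullbackPushforwardAdjunction i).homEquiv M N).symm θ).app V s) = s := h3
  have h5 := ((((pullbackPushforwardAdjunction i).homEquiv M N).symm θ).app V s).2
  rw [← h4]
  exact h5

end Modules

end AlgebraicGeometry.Scheme

/-! ### The kernel of restriction to an effective Cartier divisor. -/

namespace AlgebraicGeometry.Scheme

/-- Families of germs of functions at the points of `V`. -/
def GermFamily (Z : Scheme.{0}) (V : Z.Opens) : Type := ∀ z : V, Z.presheaf.stalk z.1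

instance (Z : Scheme.{0}) (V : Z.Opens) : CommRing (Z.GermFamily V) :=
  inferInstanceAs (CommRing (∀ z : V, Z.presheaf.stalk z.1))

instance (Z : Scheme.{0}) (V : Z.Opens) : Module Γ(Z, V) (Z.GermFamily V) :=
  Module.compHom _ (S := Γ(Z, V)) (R := Z.GermFamily V)
    (RingHom.pi fun z : V => (Z.presheaf.germ V z.1 z.2).hom)

/-- Restriction of families of germs. -/
def GermFamily.res {Z : Scheme.{0}} {U V : Z.Opens} (i : V ⟶ U) : Z.GermFamily U →+ Z.GermFamily V where
  toFun s z := s ⟨z.1, i.le z.2⟩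
  map_zero' := rfl
  map_add' _ _ := rfl

lemma GermFamily.res_smul {Z : Scheme.{0}} {U V : Z.Opens} (i : V ⟶ U) (r : Γ(Z, U))
    (s : Z.GermFamily U) : GermFamily.res i (r • s) = Z.presheaf.map i.op r • GermFamily.res i s :=
  funext fun z => congrArg (· * s ⟨z.1, i.le z.2⟩)
    (TopCat.Presheaf.germ_res_apply Z.presheaf i z.1 z.2 r).symm

/-- The sheaf of families of germs of functions, as a presheaf of modules. -/
def germFamilyPresheaf (Z : Scheme.{0}) : Z.PresheafOfModules where
  obj U := ModuleCat.of Γ(Z, U.unop) (Z.GermFamily U.unop)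
  map {_ V} i := ModuleCat.ofHom
    (Y := (ModuleCat.restrictScalars (Z.presheaf.map i).hom).obj
      (ModuleCat.of Γ(Z, V.unop) (Z.GermFamily V.unop)))
    { toFun := GermFamily.res i.unop
      map_add' := (GermFamily.res i.unop).map_add
      map_smul' := GermFamily.res_smul i.unop }
  map_id _ := rfl
  map_comp _ _ := rfl

/-- The sheaf of modules of families of germs of functions. -/
def germFamilySheaf (Z : Scheme.{0}) : Z.Modules where
  val := Z.germFamilyPresheaf
  isSheaf := by
    refine (TopCat.Presheaf.isSheaf_iff_isSheaf_comp (CategoryTheory.forget AddCommGrpCat) _).2 ?_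
    refine TopCat.Presheaf.isSheaf_of_isSheafUniqueGluing_types _ ?_
    intro ι U sf hsf
    let t : ∀ i, Z.GermFamily (U i) := sf
    have key : ∀ (i j : ι) (z : Z) (hi : z ∈ U i) (hj : z ∈ U j), t i ⟨z, hi⟩ = t j ⟨z, hj⟩ :=
      fun i j z hi hj => congrFun (hsf i j : GermFamily.res (Opens.infLELeft (U i) (U j)) (t i) =
        GermFamily.res (Opens.infLERight (U i) (U j)) (t j)) ⟨z, hi, hj⟩
    have hx : ∀ x : (iSup U : Z.Opens), ∃ i, x.1 ∈ U i := fun x => Opens.mem_iSup.1 x.2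
    choose c hc using hx
    let s : Z.GermFamily (iSup U) := fun x => t (c x) ⟨x.1, hc x⟩
    refine ⟨s, fun i => funext fun x => key _ _ _ _ _, fun s' hs' => funext fun x => ?_⟩
    exact congrFun (hs' (c x) : GermFamily.res (Opens.leSupr U (c x)) s' = t (c x)) ⟨x.1, hc x⟩

namespace CartierDivisor

variable {X : Scheme.{0}} [IsIntegral X]

lemma memStalk_iff_of_germ_eq {D E : X.CartierDivisor} {x : X} {t : (X.functionField)ˣ}
    (h : QuotientGroup.mk t * D.germ x = E.germ x) (g : X.functionField) :
    E.MemStalk x g ↔ D.MemStalk x (g * t) := by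
  obtain ⟨φ, hφ⟩ := D.exists_germ_eq x
  have hE : QuotientGroup.mk (t * φ) = E.germ x := by rw [← h, ← hφ]; rfl
  rw [memStalk_iff hφ, memStalk_iff hE, Units.val_mul, mul_assoc]

lemma memStalk_sub_iff {D F : X.CartierDivisor} {x : X} {φ : (X.functionField)ˣ}
    (hφ : QuotientGroup.mk φ = D.germ x) (g : X.functionField) :
    (D - F).MemStalk x g ↔ (-F).MemStalk x (g * φ) :=
  memStalk_iff_of_germ_eq (by rw [hφ, sub_eq_add_neg, germ_add]) g

/-- The germ of functions corresponding to a local section of `𝒪_X(D)` in a trivialization. -/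
def toStalk (D : X.CartierDivisor) {x : X} {g : X.functionField} (hg : D.MemStalk x g) :
    X.presheaf.stalk x :=
  (hg _ (D.exists_germ_eq x).choose_spec).choose

lemma algebraMap_toStalk (D : X.CartierDivisor) {x : X} {g : X.functionField}
    (hg : D.MemStalk x g) : algebraMap (X.presheaf.stalk x) X.functionField (D.toStalk hg) =
      g * (D.exists_germ_eq x).choose :=
  (hg _ (D.exists_germ_eq x).choose_spec).choose_spec

lemma algebraMap_stalk_injective (x : X) :
    Function.Injective (algebraMap (X.presheaf.stalk x) X.functionField) :=
  IsFractionRing.injective (X.presheaf.stalk x) X.functionField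

variable {Z : Scheme.{0}} (i : Z ⟶ X) (D : X.CartierDivisor)

/-- Restriction of sections of `𝒪_X(D)` to families of germs of functions on `Z`, by means of
the choice of a local equation at each point. -/
def toGermFamily : D.sheaf ⟶ (Modules.pushforward i).obj Z.germFamilySheaf :=
  ⟨PresheafOfModules.homMk
    { app := fun W => AddCommGrpCat.ofHom (X := AddCommGrpCat.of (D.sections W.unop))
        (Y := AddCommGrpCat.of (Z.GermFamily (i ⁻¹ᵁ W.unop)))
        { toFun := fun s z => i.stalkMap z.1 (D.toStalk (s.2.2 ⟨i z.1, z.2⟩))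
          map_zero' := funext fun z => by
            refine (congrArg _ (algebraMap_stalk_injective _ ?_)).trans (map_zero _)
            rw [algebraMap_toStalk, map_zero]
            exact zero_mul _
          map_add' := fun a b => funext fun z => by
            refine (congrArg _ (algebraMap_stalk_injective _ ?_)).trans (map_add _ _ _)
            rw [algebraMap_toStalk, map_add, algebraMap_toStalk, algebraMap_toStalk]
            exact add_mul _ _ _ }
      naturality := fun W W' j => rfl }
    fun W r s => funext fun z => by
      let s' : D.sections W.unop := s
      let r' : Γ(X, W.unop) := r
      have h1 : D.toStalk ((r' • s').2.2 ⟨i z.1, z.2⟩) =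
          X.presheaf.germ W.unop (i z.1) z.2 r' * D.toStalk (s'.2.2 ⟨i z.1, z.2⟩) := by
        apply algebraMap_stalk_injective
        rw [algebraMap_toStalk, map_mul, algebraMap_toStalk, ← mul_assoc]
        rfl
      refine (congrArg (i.stalkMap z.1) h1).trans ((map_mul _ _ _).trans ?_)
      exact congrArg (· * i.stalkMap z.1 (D.toStalk (s'.2.2 ⟨i z.1, z.2⟩)))
        (i.germ_stalkMap_apply W.unop z.1 z.2 r')⟩

variable {i D} {F : X.CartierDivisor}

/-- A vanishing germ vanishes on a neighborhood in `Z`. This can be shrunk to the preimage of an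
open subset of `X`, where the ideal sheaf description of `F` applies. -/
lemma IsDivisorOf.memStalk_of_stalkMap_eq_zero (hi : Topology.IsInducing i) (hF : F.IsDivisorOf i)
    {z : Z} {r : X.presheaf.stalk (i z)} (hr : i.stalkMap z r = 0) :
    (-F).MemStalk (i z) (algebraMap (X.presheaf.stalk (i z)) X.functionField r) := by
  obtain ⟨W, hzW, r, rfl⟩ := X.presheaf.exists_germ_eq r
  rw [Scheme.Hom.germ_stalkMap_apply, ← map_zero (Z.presheaf.germ (i ⁻¹ᵁ W) z hzW).hom] at hr
  obtain ⟨V, hzV, a, b, hab⟩ := Z.presheaf.germ_eq z _ _ _ _ hr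
  obtain ⟨W', hW', hWV⟩ := hi.isOpen_iff.1 V.isOpen
  have hle : i ⁻¹ᵁ (W ⊓ ⟨W', hW'⟩) ≤ V := fun y hy => by
    have : y ∈ i ⁻¹' W' := hy.2
    rw [hWV] at this; exact this
  have hzW₁ : i z ∈ W' := by rw [← Set.mem_preimage, hWV]; exact hzV
  have hzW' : i z ∈ W ⊓ (⟨W', hW'⟩ : X.Opens) := ⟨hzW, hzW₁⟩
  have : Nonempty (W ⊓ ⟨W', hW'⟩ : X.Opens) := ⟨⟨i z, hzW'⟩⟩
  refine (hF (W ⊓ ⟨W', hW'⟩) _).2 ⟨X.presheaf.map (homOfLE inf_le_left).op r, ?_, ?_⟩ (i z) hzW'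
  · refine (ConcreteCategory.congr_hom
      (i.naturality (homOfLE (inf_le_left : W ⊓ ⟨W', hW'⟩ ≤ W)).op) r).trans ?_
    have h2 := congrArg (Z.presheaf.map (homOfLE hle).op) hab
    have h3 := ConcreteCategory.congr_hom (Z.presheaf.map_comp a.op (homOfLE hle).op) (i.app W r)
    refine h3.trans (h2.trans ?_)
    exact (congrArg _ (map_zero _)).trans (map_zero _)
  · rw [← X.algebraMap_germ_eq_germToFunctionField hzW']
    congr 1
    exact TopCat.Presheaf.germ_res_apply X.presheaf _ _ _ _

/-- Over the complement of the image the preimage is empty, so even the function `1` belongs to the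
ideal sheaf. -/
lemma IsDivisorOf.memStalk_one (hi : IsClosed (Set.range i)) (hF : F.IsDivisorOf i) {x : X}
    (hx : x ∉ Set.range i) : (-F).MemStalk x 1 := by
  let W : X.Opens := ⟨(Set.range i)ᶜ, hi.isOpen_compl⟩
  have : Nonempty W := ⟨⟨x, hx⟩⟩
  have hW : i ⁻¹ᵁ W = ⊥ := by ext z; simp [W]
  have : Subsingleton Γ(Z, i ⁻¹ᵁ W) := by
    rw [hW]; infer_instance
  exact (hF W 1).2 ⟨1, Subsingleton.elim _ _, map_one _⟩ x hx

lemma IsDivisorOf.exists_of_germ_eq (hF : F.IsDivisorOf i) {x : X} {φ : (X.functionField)ˣ}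
    (hφ : QuotientGroup.mk φ = F.germ x) :
    (φ : X.functionField) ∈ (algebraMap (X.presheaf.stalk x) X.functionField).range := by
  obtain ⟨W, hxW, ψ, hψ⟩ := (Additive.toMul F).2 x
  have : Nonempty W := ⟨⟨x, hxW⟩⟩
  obtain ⟨s, -, hs⟩ := (hF W ψ).1 (fun y hy => (memStalk_iff (φ := ψ⁻¹) (by
    rw [germ_neg]; exact congrArg (·⁻¹) (hψ y hy).symm) _).2 ⟨1, by rw [map_one, Units.mul_inv]⟩)
  obtain ⟨u, hu⟩ := mk_eq_mk_iff.1 (((hψ x hxW).symm : QuotientGroup.mk ψ = F.germ x).trans hφ.symm)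
  rw [← hu, ← hs, ← X.algebraMap_germ_eq_germToFunctionField hxW s, ← map_mul]
  exact ⟨_, rfl⟩

lemma IsDivisorOf.memStalk_of_sub (hF : F.IsDivisorOf i) {x : X} {g : X.functionField}
    (hg : (D - F).MemStalk x g) : D.MemStalk x g := by
  obtain ⟨φ, hφ⟩ := D.exists_germ_eq x
  obtain ⟨ψ, hψ⟩ := F.exists_germ_eq x
  rw [memStalk_sub_iff hφ, memStalk_iff (φ := ψ⁻¹) (by rw [germ_neg, ← hψ]; rfl)] at hg
  rw [memStalk_iff hφ]
  have := mul_mem hg (hF.exists_of_germ_eq hψ)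
  rwa [mul_assoc, Units.inv_mul, mul_one] at this

/-- The kernel of `𝒪_X(D) ⟶ i_* i^* 𝒪_X(D)` is `𝒪_X(D - F)`, if `i` is the inclusion of the
effective divisor `F`. -/
theorem IsDivisorOf.unit_app_eq_zero_iff [IsClosedImmersion i] (hF : F.IsDivisorOf i) {W : X.Opens}
    (s : D.sections W) :
    (Modules.unit i D.sheaf).app W s = 0 ↔ ∀ x : W, (D - F).MemStalk x.1 (s.1 x) := by
  constructor
  · intro h x
    by_cases hx : x.1 ∈ Set.range i
    · obtain ⟨x, hxW⟩ := x
      obtain ⟨z, rfl⟩ := hx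
      -- The germ families detect the kernel: the map to them factors through the unit by
      -- adjunction, so a section killed by the unit has, in a trivialization at each point, a
      -- function vanishing on `Z`. The trivializations need no compatibility, because germ families
      -- carry no continuity condition.
      let θ' := ((Modules.pullbackPushforwardAdjunction i).homEquiv D.sheaf Z.germFamilySheaf).symm
        (D.toGermFamily i)
      have h1 : Modules.unit i D.sheaf ≫ (Modules.pushforward i).map θ' = D.toGermFamily i := by
        rw [← Adjunction.homEquiv_unit, Equiv.apply_symm_apply]
      have h2 : (D.toGermFamily i).app W s = 0 := by
        rw [← h1]
        exact (congrArg (θ'.app (i ⁻¹ᵁ W)).hom h).trans (map_zero _)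
      have h3 : i.stalkMap z (D.toStalk (s.2.2 ⟨i z, hxW⟩)) = 0 := congrFun h2 ⟨z, hxW⟩
      rw [memStalk_sub_iff (D.exists_germ_eq (i z)).choose_spec, ← D.algebraMap_toStalk (s.2.2 ⟨i z, hxW⟩)]
      exact hF.memStalk_of_stalkMap_eq_zero i.isEmbedding.isInducing h3
    · obtain ⟨φ, hφ⟩ := D.exists_germ_eq x.1
      rw [memStalk_sub_iff hφ]
      obtain ⟨r, hr⟩ := s.2.2 x φ hφ
      rw [← hr, ← mul_one (algebraMap _ _ r)]
      exact (hF.memStalk_one i.isClosedEmbedding.isClosed_range hx).smul r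
  · intro h
    -- Locally the section is `r • e`, with `e` a generator of `𝒪_X(D)` and `r` in the ideal of `F`.
    -- The unit is linear over restriction of functions, so `r` acts as zero on its target.
    have H : ∀ z : i ⁻¹ᵁ W, ∃ (W' : X.Opens) (j : W' ≤ W), i z.1 ∈ W' ∧
        (Modules.unit i D.sheaf).app W' (D.res (homOfLE j) s) = 0 := by
      rintro ⟨z, hz⟩
      obtain ⟨W₁, hzW₁, φ, hφ⟩ := (Additive.toMul D).2 (i z)
      have hφ' : ∀ x ∈ W₁, QuotientGroup.mk φ = D.germ x := fun x hx => (hφ x hx).symm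
      have : Nonempty (W₁ ⊓ W : X.Opens) := ⟨⟨i z, hzW₁, hz⟩⟩
      let e : D.sections (W₁ ⊓ W) := ⟨fun _ => (φ⁻¹ : (X.functionField)ˣ), fun _ _ => rfl,
        fun x => (memStalk_iff (hφ' x.1 x.2.1) _).2 ⟨1, by rw [map_one, Units.inv_mul]⟩⟩
      obtain ⟨r, hr, hrs⟩ := (hF (W₁ ⊓ W) (s.1 ⟨i z, hz⟩ * φ)).1 (fun x hx => by
        rw [← memStalk_sub_iff (hφ' x hx.1), s.2.1 ⟨i z, hz⟩ ⟨x, hx.2⟩]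
        exact h ⟨x, hx.2⟩)
      have hre : D.res (homOfLE inf_le_right) s = r • e := by
        refine Subtype.ext (funext fun x => ?_)
        have h1 : ratFun (W₁ ⊓ W) r x = s.1 ⟨i z, hz⟩ * φ :=
          (X.algebraMap_germ_eq_germToFunctionField x.2 r).trans hrs
        change s.1 ⟨x.1, x.2.2⟩ = ratFun (W₁ ⊓ W) r x * (φ⁻¹ : (X.functionField)ˣ)
        rw [h1, mul_assoc, Units.mul_inv, mul_one]
        exact s.2.1 _ _
      refine ⟨W₁ ⊓ W, inf_le_right, ⟨hzW₁, hz⟩, ?_⟩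
      rw [hre]
      refine (Modules.Hom.app_smul (Modules.unit i D.sheaf) (U := W₁ ⊓ W) r e).trans ?_
      have h2 : i.app (W₁ ⊓ W) r • (show Γ((Modules.pullback i).obj D.sheaf, i ⁻¹ᵁ (W₁ ⊓ W)) from
          (Modules.unit i D.sheaf).app (W₁ ⊓ W) e) = 0 := by
        rw [hr, zero_smul]
      exact h2
    choose W' j hzW' hW' using H
    refine TopCat.Sheaf.eq_of_locally_eq' (⟨((Modules.pullback i).obj D.sheaf).presheaf,
      ((Modules.pullback i).obj D.sheaf).isSheaf⟩ : TopCat.Sheaf AddCommGrpCat Z)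
      (fun z => i ⁻¹ᵁ (W' z)) (i ⁻¹ᵁ W) (fun z => homOfLE (i.preimage_mono (j z)))
      (fun z hz => Opens.mem_iSup.2 ⟨⟨z, hz⟩, hzW' _⟩) _ _ (fun z => ?_)
    exact (Modules.unit_app_map i D.sheaf (j z) s).symm.trans ((hW' z).trans (map_zero _).symm)

end CartierDivisor

end AlgebraicGeometry.Scheme

/-! ### The twisted restriction sequence and its cohomology. -/

namespace AlgebraicGeometry.Scheme

/-- The sheaf of abelian groups underlying a sheaf of modules. -/
abbrev Modules.abSheaf {X : Scheme.{0}} (M : X.Modules) : TopCat.AbSheaf X :=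
  (SheafOfModules.toSheaf X.ringCatSheaf).obj M

namespace CartierDivisor

lemma preimage_le_preimage_inf {X Z : Scheme.{0}} {i : Z ⟶ X} {V : X.Opens} (hV : ∀ z, i z ∈ V)
    (W : X.Opens) : i ⁻¹ᵁ W ≤ i ⁻¹ᵁ (W ⊓ V) :=
  fun z hz => ⟨hz, hV z⟩

variable {X : Scheme.{0}} [IsIntegral X] {Z : Scheme.{0}} {i : Z ⟶ X} {D E F : X.CartierDivisor}

/-- The inclusion of `𝒪_X(E - F)` into `𝒪_X(E)` for an effective divisor `F`. -/
def IsDivisorOf.subInclusion (hF : F.IsDivisorOf i) (E : X.CartierDivisor) :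
    (E - F).sheaf.abSheaf ⟶ E.sheaf.abSheaf where
  hom :=
    { app := fun W => AddCommGrpCat.ofHom (X := AddCommGrpCat.of ((E - F).sections W.unop))
        (Y := AddCommGrpCat.of (E.sections W.unop))
        { toFun := fun s => ⟨s.1, s.2.1, fun x => hF.memStalk_of_sub (s.2.2 x)⟩
          map_zero' := rfl
          map_add' := fun _ _ => rfl }
      naturality := fun _ _ _ => rfl }

section

variable {t : (X.functionField)ˣ} {V : X.Opens}
  (ht : ∀ x ∈ V, QuotientGroup.mk t * D.germ x = E.germ x)

/-- Multiplication by a rational function, as a map from sections of `𝒪_X(E)` to sections of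
`𝒪_X(D)` over a smaller open subset. -/
def mulSections (W : X.Opens) : E.sections W →+ D.sections (W ⊓ V) where
  toFun s := ⟨fun x => s.1 ⟨x.1, x.2.1⟩ * t, fun _ _ => congrArg (· * (t : X.functionField)) (s.2.1 _ _),
    fun x => (memStalk_iff_of_germ_eq (ht x.1 x.2.2) _).1 (s.2.2 ⟨x.1, x.2.1⟩)⟩
  map_zero' := Subtype.ext (funext fun _ => zero_mul _)
  map_add' _ _ := Subtype.ext (funext fun _ => add_mul _ _ _)

variable (hV : ∀ z, i z ∈ V)

/-- The morphism `𝒪_X(E) ⟶ i_* i^* 𝒪_X(D)` given by a rational function `t` which induces an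
isomorphism from `𝒪_X(E)` to `𝒪_X(D)` in a neighborhood of the image of `i`. -/
def restrictTwist :
    E.sheaf.abSheaf ⟶ (TopCat.directImage i.base).obj ((Modules.pullback i).obj D.sheaf).abSheaf where
  hom :=
    { app := fun W => AddCommGrpCat.ofHom (X := AddCommGrpCat.of (E.sections W.unop))
        (Y := ((Modules.pullback i).obj D.sheaf).presheaf.obj (op (i ⁻¹ᵁ W.unop)))
        (((((Modules.pullback i).obj D.sheaf).presheaf.map
          (homOfLE (preimage_le_preimage_inf hV W.unop)).op).hom.comp
          ((Modules.unit i D.sheaf).app (W.unop ⊓ V)).hom).comp (mulSections ht W.unop))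
      naturality := fun W W' j => by
        ext s
        have h1 := Modules.unit_app_map i D.sheaf (inf_le_inf_right V j.unop.le)
          (mulSections ht W.unop s)
        refine (congrArg (((Modules.pullback i).obj D.sheaf).presheaf.map
          (homOfLE (preimage_le_preimage_inf hV W'.unop)).op) h1).trans ?_
        refine (Modules.map_map _ _ _ (homOfLE ?_) _).trans (Modules.map_map _ _ _ _ _).symm
        exact fun z hz => ⟨j.unop.le hz, hV z⟩ }

/-- On `V`, multiplication by `t` identifies `𝒪_X(E - F)` with `𝒪_X(D - F)`, the kernel of the unit.
Off `V` the divisor `F` is trivial, so the condition on the right holds automatically. -/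
lemma restrictTwist_app_eq_zero_iff [IsClosedImmersion i] (hF : F.IsDivisorOf i) {W : X.Opens}
    (s : E.sections W) :
    (restrictTwist ht hV).hom.app (op W) s = 0 ↔ ∀ x : W, (E - F).MemStalk x.1 (s.1 x) := by
  have h0 : (restrictTwist ht hV).hom.app (op W) s = 0 ↔
      (Modules.unit i D.sheaf).app (W ⊓ V) (mulSections ht W s) = 0 := by
    constructor
    · intro h
      have h1 := congrArg (((Modules.pullback i).obj D.sheaf).presheaf.map
        (homOfLE (i.preimage_mono (inf_le_left : W ⊓ V ≤ W))).op) h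
      have h2 := Modules.map_map ((Modules.pullback i).obj D.sheaf)
        (homOfLE (i.preimage_mono (inf_le_left : W ⊓ V ≤ W)))
        (homOfLE (preimage_le_preimage_inf hV W)) (𝟙 _)
        ((Modules.unit i D.sheaf).app (W ⊓ V) (mulSections ht W s))
      have h3 := ConcreteCategory.congr_hom (((Modules.pullback i).obj D.sheaf).presheaf.map_id
        (op (i ⁻¹ᵁ (W ⊓ V)))) ((Modules.unit i D.sheaf).app (W ⊓ V) (mulSections ht W s))
      exact h3.symm.trans (h2.symm.trans (h1.trans (map_zero _)))
    · intro h
      exact (congrArg (((Modules.pullback i).obj D.sheaf).presheaf.map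
        (homOfLE (preimage_le_preimage_inf hV W)).op) h).trans (map_zero _)
  rw [h0, hF.unit_app_eq_zero_iff]
  have h1 : ∀ x ∈ V, ∀ g, (E - F).MemStalk x g ↔ (D - F).MemStalk x (g * t) := fun x hx g =>
    memStalk_iff_of_germ_eq (by
      rw [sub_eq_add_neg, sub_eq_add_neg, germ_add, germ_add, ← mul_assoc, ht x hx]) g
  constructor
  · intro h x
    by_cases hx : x.1 ∈ V
    · exact (h1 x.1 hx _).2 (h ⟨x.1, x.2, hx⟩)
    · obtain ⟨φ, hφ⟩ := E.exists_germ_eq x.1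
      rw [memStalk_sub_iff hφ]
      obtain ⟨r, hr⟩ := s.2.2 x φ hφ
      rw [← hr, ← mul_one (algebraMap _ _ r)]
      refine (hF.memStalk_one i.isClosedEmbedding.isClosed_range ?_).smul r
      rintro ⟨z, hz⟩
      exact hx (hz ▸ hV z)
  · intro h x
    exact (h1 x.1 x.2.2 _).1 (h ⟨x.1, x.2.1⟩)

/-- Near `F`, lift a section to `𝒪_X(D)` by `isLocallyPulledBack` and divide by `t`. Away from `F`
the target has only zero sections. -/
instance epi_restrictTwist [IsClosedImmersion i] : Epi (restrictTwist ht hV) := by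
  rw [TopCat.AbSheaf.epi_iff]
  intro W s x hx
  by_cases hxi : x ∈ Set.range i
  · obtain ⟨z, rfl⟩ := hxi
    obtain ⟨W', h, hzW', m, hm⟩ := Modules.isLocallyPulledBack i D.sheaf (V := i ⁻¹ᵁ W) s z hx
    let m' : D.sections W' := m
    let e : E.sections (W' ⊓ W ⊓ V) := ⟨fun y => m'.1 ⟨y.1, y.2.1.1⟩ * (t⁻¹ : (X.functionField)ˣ),
      fun _ _ => congrArg (· * _) (m'.2.1 _ _), fun y => by
        rw [memStalk_iff_of_germ_eq (ht y.1 y.2.2), mul_assoc, Units.inv_mul, mul_one]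
        exact m'.2.2 ⟨y.1, y.2.1.1⟩⟩
    have hle : W' ⊓ W ⊓ V ⊓ V ≤ W' := inf_le_left.trans (inf_le_left.trans inf_le_left)
    refine ⟨W' ⊓ W ⊓ V, homOfLE (inf_le_left.trans inf_le_right), ⟨⟨hzW', hx⟩, hV z⟩, e, ?_⟩
    have h1 : mulSections ht (W' ⊓ W ⊓ V) e = D.res (homOfLE hle) m' :=
      Subtype.ext (funext fun y => by
        change m'.1 _ * (t⁻¹ : (X.functionField)ˣ) * t = m'.1 _
        rw [mul_assoc, Units.inv_mul, mul_one])
    have h2 := Modules.unit_app_map_eq hm hle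
    refine (congrArg (fun a => ((Modules.pullback i).obj D.sheaf).presheaf.map
      (homOfLE (preimage_le_preimage_inf hV (W' ⊓ W ⊓ V))).op
        ((Modules.unit i D.sheaf).app (W' ⊓ W ⊓ V ⊓ V) a)) h1).trans ?_
    refine (congrArg (((Modules.pullback i).obj D.sheaf).presheaf.map _) h2).trans ?_
    exact Modules.map_map _ _ _ _ _
  · let W' : X.Opens := ⟨(Set.range i)ᶜ, i.isClosedEmbedding.isClosed_range.isOpen_compl⟩
    refine ⟨W ⊓ W', homOfLE inf_le_left, ⟨hx, hxi⟩, 0, ?_⟩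
    have := ((Modules.pullback i).obj D.sheaf).abSheaf.subsingleton_of_eq_bot
      (U := i ⁻¹ᵁ (W ⊓ W')) (by ext z; simp [W'])
    exact Subsingleton.elim (α := ((Modules.pullback i).obj D.sheaf).abSheaf.obj.obj
      (op (i ⁻¹ᵁ (W ⊓ W')))) _ _

/-- The sequence `0 ⟶ 𝒪_X(E - F) ⟶ 𝒪_X(E) ⟶ i_* i^* 𝒪_X(D) ⟶ 0`, where `i` is the inclusion of the
effective divisor `F`, and `𝒪_X(D)` and `𝒪_X(E)` are isomorphic near `F`. -/
def IsDivisorOf.twistComplex [IsClosedImmersion i] (hF : F.IsDivisorOf i) :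
    ShortComplex (TopCat.AbSheaf X) :=
  ShortComplex.mk (hF.subInclusion E) (restrictTwist ht hV) (by
    ext W s
    exact (restrictTwist_app_eq_zero_iff ht hV hF _).2 fun x => Subtype.prop s |>.2 x)

/-- The factorization through `𝒪_X(E - F)` of a morphism to `𝒪_X(E)` which vanishes on `F`. -/
def IsDivisorOf.twistLift [IsClosedImmersion i] (hF : F.IsDivisorOf i) {G : TopCat.AbSheaf X}
    (k : G ⟶ E.sheaf.abSheaf) (hk : k ≫ restrictTwist ht hV = 0) : G ⟶ (E - F).sheaf.abSheaf where
  hom :=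
    { app := fun W => AddCommGrpCat.ofHom (Y := AddCommGrpCat.of ((E - F).sections W.unop))
        { toFun := fun a => ⟨(show E.sections W.unop from k.hom.app W a).1,
            (show E.sections W.unop from k.hom.app W a).2.1,
            (restrictTwist_app_eq_zero_iff ht hV hF _).1
              (ConcreteCategory.congr_hom (congrArg (fun φ => φ.hom.app W) hk) a)⟩
          map_zero' := Subtype.ext (congrArg (fun s : E.sections W.unop => s.1) (map_zero (k.hom.app W).hom))
          map_add' := fun a b => Subtype.ext (congrArg (fun s : E.sections W.unop => s.1)
            (map_add (k.hom.app W).hom a b)) }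
      naturality := fun W W' j => by
        ext a
        exact Subtype.ext (congrArg (fun s : E.sections W'.unop => s.1)
          (ConcreteCategory.congr_hom (k.hom.naturality j) a)) }

lemma IsDivisorOf.twistComplex_shortExact [IsClosedImmersion i] (hF : F.IsDivisorOf i) :
    (hF.twistComplex ht hV).ShortExact where
  mono_f := (TopCat.AbSheaf.mono_iff _).2 fun U a b hab => Subtype.ext
    (congrArg (fun s : E.sections U => s.1) hab)
  epi_g := epi_restrictTwist ht hV
  exact := by
    refine ShortComplex.exact_of_f_is_kernel _ (Limits.KernelFork.IsLimit.ofι _ _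
      (fun k hk => hF.twistLift ht hV k hk) (fun k hk => by ext W a; rfl) (fun k hk m hm => ?_))
    ext W a
    exact Subtype.ext (congrArg (fun s : E.sections W.unop => s.1)
      (ConcreteCategory.congr_hom (congrArg (fun φ => φ.hom.app W) hm) a))

end

/-- If the cohomology of `𝒪_X(E)` and of the restriction of `𝒪_X(D)` to the effective divisor `F`
vanishes in suitable degrees, then so does that of `𝒪_X(E - F)`, provided that `𝒪_X(D)` and
`𝒪_X(E)` are isomorphic near `F`. -/
theorem IsDivisorOf.cohomologyVanishes_sub [IsClosedImmersion i] (hF : F.IsDivisorOf i)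
    {t : (X.functionField)ˣ} {V : X.Opens}
    (ht : ∀ x ∈ V, QuotientGroup.mk t * D.germ x = E.germ x) (hV : ∀ z, i z ∈ V)
    (hD : ∀ j, 0 < j → ((Modules.pullback i).obj D.sheaf).CohomologyVanishes j)
    {j : ℕ} (hj : 1 < j) (hE : E.sheaf.CohomologyVanishes j) :
    (E - F).sheaf.CohomologyVanishes j := by
  obtain ⟨j, rfl⟩ := Nat.exists_eq_succ_of_ne_zero (Nat.ne_zero_of_lt hj)
  have hS := hF.twistComplex_shortExact ht hV
  -- Here `j` is one less than the original degree, so the bound `1 < j` makes it positive, as the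
  -- vanishing on `F` requires.
  have h1 : Subsingleton (Sheaf.H ((TopCat.directImage i.base).obj
      ((Modules.pullback i).obj D.sheaf).abSheaf) j) :=
    TopCat.subsingleton_H_directImage i.isClosedEmbedding j _ hD (by omega)
  refine subsingleton_of_forall_eq 0 fun x => ?_
  have hE' : Subsingleton (Sheaf.H E.sheaf.abSheaf (j + 1)) := hE
  obtain ⟨y, rfl⟩ := Abelian.Ext.covariant_sequence_exact₁ _ hS x
    (Subsingleton.elim (α := Sheaf.H E.sheaf.abSheaf (j + 1)) _ _) rfl
  have hy : y = 0 := Subsingleton.elim (α := Sheaf.H ((TopCat.directImage i.base).obj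
    ((Modules.pullback i).obj D.sheaf).abSheaf) j) _ _
  rw [hy, Abelian.Ext.zero_comp]
  rfl

end CartierDivisor

end AlgebraicGeometry.Scheme

end

/-! ### Induction on the multiple of the fiber. -/

theorem lemma3p2 (n : ℕ) (X C : Scheme.{0}) [IsIntegral X]
    (πX : X ⟶ Spec (CommRingCat.of ℂ)) (πC : C ⟶ Spec (CommRingCat.of ℂ))
    (hX : IsProjectiveManifold πX n) (hC : IsProjectiveCurve πC)
    (f : X ⟶ C) (hfC : f ≫ πC = πX) (hf : IsAlgebraicFiberSpace f)
    (H : X.CartierDivisor) (hH : H.IsAmple)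
    (p : C) (hp : IsClosed ({p} : Set C))
    (F : X.CartierDivisor) (hF : F.IsDivisorOf (f.fiberι p))
    (m₀ : ℕ)
    (hvanX : ∀ m : ℕ, m₀ ≤ m → ∀ i : ℕ, 0 < i → (m • H).sheaf.CohomologyVanishes i)
    (hvanF : ∀ m : ℕ, m₀ ≤ m → ∀ i : ℕ, 0 < i →
      ((Scheme.Modules.pullback (f.fiberι p)).obj (m • H).sheaf).CohomologyVanishes i) :
    (∀ m : ℕ, m₀ ≤ m → ∀ k i : ℕ, 1 < i → (m • H - k • F).sheaf.CohomologyVanishes i) ∧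
    (∀ a b : ℕ, 0 < a → 0 < b → ∃ m₁ : ℕ, ∀ m : ℕ, m₁ ≤ m → ∀ i : ℕ, 1 < i →
      (m • (a • H - b • F)).sheaf.CohomologyVanishes i) := by
  have := hC.integral
  have := hC.projective.isLocallyNoetherian
  have := f.isClosedImmersion_fiberι hp
  obtain ⟨V, hV, t, ht⟩ := hF.exists_equation_near_fiber hC.dim_eq.le f hf.surjective hf.isIso_app hp
  have hV' : ∀ z, f.fiberι p z ∈ V := fun z => hV _ (by
    have : f.fiberι p z ∈ Set.range (f.fiberι p) := ⟨z, rfl⟩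
    rwa [Scheme.Hom.range_fiberι] at this)
  have key : ∀ m : ℕ, m₀ ≤ m → ∀ k i : ℕ, 1 < i →
      (m • H - k • F).sheaf.CohomologyVanishes i := by
    intro m hm k i hi
    induction k with
    | zero =>
      rw [zero_smul, sub_zero]
      exact hvanX m hm i (by omega)
    | succ k ih =>
      rw [show m • H - (k + 1) • F = m • H - k • F - F by rw [succ_nsmul]; abel]
      -- With `D = mH` and `E = mH - kF`, local equations near `F` differ by the factor `t⁻ᵏ`, since
      -- `t` is an equation of `F` there. Only the vanishing for `mH` on the fiber is therefore
      -- needed, for every `k`.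
      refine hF.cohomologyVanishes_sub (t := (t ^ k)⁻¹) (fun x hx => ?_) hV' (hvanF m hm) hi ih
      rw [sub_eq_add_neg, Scheme.CartierDivisor.germ_add, Scheme.CartierDivisor.germ_neg,
        Scheme.CartierDivisor.germ_nsmul F k, ← ht x hx]
      exact mul_comm _ ((m • H).germ x)
  -- The bound `m₀` itself works: `a > 0` gives `m * a ≥ m ≥ m₀`.
  refine ⟨key, fun a b ha _ => ⟨m₀, fun m hm i hi => ?_⟩⟩
  have h : m • (a • H - b • F) = (m * a) • H - (m * b) • F := by
    rw [mul_nsmul', mul_nsmul']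
    exact nsmul_sub (a • H) (b • F) m
  rw [h]
  exact key _ (hm.trans (Nat.le_mul_of_pos_right m ha)) _ i hi
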